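/- Let $D\ge 0$, $N\ge 0$ be integers, $t_0<t_f$, $\Omega=[t_0,t_f]$, $\mathbf F:\mathbb R^D\times\Omega\to\mathbb R^D$, $\mathbf u_0\in\mathbb R^D$, and let $|\cdot|$ be the maximum norm on $\mathbb R^D$. Let $\tau_0<\dots<\tau_N$ be the roots of the shifted Legendre polynomial of degree $N+1$ on $[0,1]$, $\varphi_0,\dots,\varphi_N$ the Lagrange basis polynomials of degree $N$ on these nodes, $w_p=\int_0^1\varphi_p\,d\tau$, $K_{pq}=\varphi_p(1)\varphi_q(1)-\int_0^1\varphi_p'\varphi_q\,d\tau$, $M_{pq}=\int_0^1\varphi_p\varphi_q\,d\tau$, and $A=K^{-1}M$. For a grid $t_0<t_1<\dots<t_M=t_f$ (not necessarily uniform) put $\Delta t_n=t_{n+1}-t_n$, $\Delta t=\max_n\Delta t_n$, $\Omega_n=[t_n,t_{n+1}]$ and $t(\tau)=t_n+\tau\Delta t_n$. The ADER-DG solution with local DG predictor of $\mathbf u'=\mathbf F(\mathbf u,t)$, $\mathbf u(t_0)=\mathbf u_0$, consists of nodal values $\mathbf u_n$ ($\mathbf u_0$ being the initial value) and coefficients $\hat{\mathbf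 q}_{n,p}$ with $$\hat{\mathbf q}_{n,p}-\Delta t_n\sum_{q=0}^N A_{pq}\mathbf F(\hat{\mathbf q}_{n,q},t(\tau_q))=\mathbf u_n,\qquad \mathbf u_{n+1}=\mathbf u_n+\Delta t_n\sum_{p=0}^N w_p\mathbf F(\hat{\mathbf q}_{n,p},t(\tau_p)).$$ The local solution is $\mathbf q_n(\tau)=\sum_p\hat{\mathbf q}_{n,p}\varphi_p(\tau)$, and the improved local solution is $$\mathbf q_n^{\rm IL}(\tau)=\mathbf u_n+\Delta t_n\int_0^\tau\sum_{p=0}^N\mathbf F(\hat{\mathbf q}_{n,p},t(\tau_p))\varphi_p(\xi)\,d\xi,$$ that is, $\mathbf u_n+\Delta t_n\int_0^\tau\mathbf F(\mathbf q_n(\xi),t(\xi))\,d\xi$ with the integrand replaced by its interpolant at the Gauss nodes. The functions $\mathbf u_L$ and $\mathbf u_{\rm IL}$ on $\Omega$ are assembled piecewise from $\mathbf q_n((t-t_n)/\Delta t_n)$ and $\mathbf q_n^{\rm IL}((t-t_n)/\Delta t_n)$ on the cells (the cell $[t_n,t_{n+1})$, closed on the right for the last one). (a) For every grid and every ADER-DG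 solution on it, $\mathbf q_n^{\rm IL}(\tau)=\mathbf u_n+\Delta t_n\sum_p\mathbf F(\mathbf q_n(\tau_p),t(\tau_p))\int_0^\tau\varphi_p(\xi)\,d\xi$, $\mathbf q_n^{\rm IL}(0)=\mathbf u_n$ and $\mathbf q_n^{\rm IL}(1)=\mathbf u_{n+1}$ for all $n$; hence $\mathbf u_{\rm IL}(t_n)=\mathbf u_n$ at all grid nodes and $\mathbf u_{\rm IL}$ is continuous on $\Omega$. (b) Let $N\ge1$, let $\mathbf F$ be of class $C^{N+2}$ on $\mathbb R^D\times\Omega$ and Lipschitz in its first argument, uniformly on $\Omega$: $|\mathbf F(\mathbf x,t)-\mathbf F(\mathbf y,t)|\le L_F|\mathbf x-\mathbf y|$ for all $\mathbf x,\mathbf y\in\mathbb R^D$, $t\in\Omega$. Let $\mathbf u$ be the exact solution of the initial value problem on $\Omega$. Then there are $C>0$ and $\delta>0$, independent of the grid, such that on every grid with $\Delta t\le\delta$ an ADER-DG solution exists, and every ADER-DG solution satisfies $$\sup_{t\in\Omega}|\mathbf u_{\rm IL}(t)-\mathbf u(t)|\le C\,\Delta t^{N+2},\qquad \|\mathbf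 u_{\rm IL}-\mathbf u\|_{L_\infty(\Omega)}\le C\,\Delta t^{N+2},\qquad \|\mathbf u_{\rm IL}-\mathbf u\|_{L_p(\Omega)}\le |\Omega|^{1/p}C\,\Delta t^{N+2}\quad(1\le p<\infty),$$ one order higher than the estimates for the local solution, which are $\|\mathbf u_L-\mathbf u\|_{L_\infty(\Omega)}\le C\,\Delta t^{N+1}$ and $\|\mathbf u_L-\mathbf u\|_{L_p(\Omega)}\le|\Omega|^{1/p}C\,\Delta t^{N+1}$ $(1\le p<\infty)$. -/

import Mathlib

open MeasureTheory Set Polynomial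

noncomputable section

namespace ADERDG

/-- The shifted Legendre polynomial on `[0, 1]` of degree `n`, with real coefficients. -/
def legendre (n : ℕ) : ℝ[X] :=
  (Polynomial.shiftedLegendre n).map (Int.castRingHom ℝ)

/-- The Gauss nodes `τ_0 < ⋯ < τ_N`: the real roots of the shifted Legendre polynomial of
degree `N + 1`, in ascending order. That polynomial has `N + 1` distinct real roots, so the
default value of `getD` is never used. -/
def node (N : ℕ) (k : Fin (N + 1)) : ℝ :=
  ((legendre (N + 1)).roots.toFinset.sort (· ≤ ·)).getD k 0

/-- The Lagrange basis polynomials `φ_p` on the Gauss nodes. -/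
def phi (N : ℕ) (p : Fin (N + 1)) : ℝ[X] :=
  Lagrange.basis Finset.univ (node N) p

/-- The Gauss-Legendre weights `w_p = ∫₀¹ φ_p`. -/
def weight (N : ℕ) (p : Fin (N + 1)) : ℝ :=
  ∫ τ in (0 : ℝ)..1, (phi N p).eval τ

/-- `K_pq = φ_p(1) φ_q(1) - ∫₀¹ φ_p' φ_q`. -/
def matK (N : ℕ) : Matrix (Fin (N + 1)) (Fin (N + 1)) ℝ :=
  Matrix.of fun p q => (phi N p).eval 1 * (phi N q).eval 1 -
    ∫ τ in (0 : ℝ)..1, (derivative (phi N p)).eval τ * (phi N q).eval τ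

/-- `M_pq = ∫₀¹ φ_p φ_q`. -/
def matM (N : ℕ) : Matrix (Fin (N + 1)) (Fin (N + 1)) ℝ :=
  Matrix.of fun p q => ∫ τ in (0 : ℝ)..1, (phi N p).eval τ * (phi N q).eval τ

/-- `A = K⁻¹ M`. -/
def matA (N : ℕ) : Matrix (Fin (N + 1)) (Fin (N + 1)) ℝ :=
  (matK N)⁻¹ * matM N

/-- A grid `t_0 < t_1 < ⋯ < t_M = t_f` with `M` cells, not necessarily uniform. -/
structure Grid (t₀ tf : ℝ) (M : ℕ) where
  pt : Fin (M + 1) → ℝ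
  strictMono : StrictMono pt
  first : pt 0 = t₀
  last : pt (Fin.last M) = tf

namespace Grid

variable {t₀ tf : ℝ} {M : ℕ}

/-- `Δt_n = t_{n+1} - t_n`. -/
def step (g : Grid t₀ tf M) (n : Fin M) : ℝ :=
  g.pt n.succ - g.pt n.castSucc

/-- `Δt = max_n Δt_n`. -/
def mesh (g : Grid t₀ tf M) : ℝ :=
  ⨆ n, g.step n

/-- `t(τ) = t_n + τ Δt_n`. -/
def time (g : Grid t₀ tf M) (n : Fin M) (τ : ℝ) : ℝ :=
  g.pt n.castSucc + τ * g.step n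

/-- The cells, made disjoint: `[t_n, t_{n+1})`, and the closed interval for the last one. -/
def cell (g : Grid t₀ tf M) (n : Fin M) : Set ℝ :=
  if (n : ℕ) + 1 = M then Icc (g.pt n.castSucc) (g.pt n.succ)
  else Ico (g.pt n.castSucc) (g.pt n.succ)

/-- The piecewise assembly `t ↦ ∑ₙ χₙ(t) vₙ((t - tₙ) / Δtₙ)`. -/
def assemble {D : ℕ} (g : Grid t₀ tf M) (v : Fin M → ℝ → Fin D → ℝ) (t : ℝ) : Fin D → ℝ :=
  ∑ n, (g.cell n).indicator (fun s => v n ((s - g.pt n.castSucc) / g.step n)) t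

end Grid

variable {D N M : ℕ} {t₀ tf : ℝ}

/-- `U` (nodal values `u_n`) and `Q` (predictor coefficients `q̂_{n,p}`) solve the ADER-DG method
with local DG predictor for `u' = F(u, t)`, `u(t₀) = u₀`, on the grid `g`. -/
structure IsSolution (F : (Fin D → ℝ) → ℝ → Fin D → ℝ) (u₀ : Fin D → ℝ) (g : Grid t₀ tf M)
    (U : Fin (M + 1) → Fin D → ℝ) (Q : Fin M → Fin (N + 1) → Fin D → ℝ) : Prop where
  init : U 0 = u₀
  predictor : ∀ n p,
    Q n p - g.step n • ∑ q, matA N p q • F (Q n q) (g.time n (node N q)) = U n.castSucc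
  update : ∀ n,
    U n.succ = U n.castSucc + g.step n • ∑ p, weight N p • F (Q n p) (g.time n (node N p))

/-- The local solution on a cell, `q_n(τ) = ∑_p q̂_{n,p} φ_p(τ)`. -/
def localSol (Q : Fin M → Fin (N + 1) → Fin D → ℝ) (n : Fin M) (τ : ℝ) : Fin D → ℝ :=
  ∑ p, (phi N p).eval τ • Q n p

/-- The point-wise evaluation of `F(q_n(τ), t(τ))`: its Lagrange interpolant on the Gauss nodes,
`∑_p F(q_n(τ_p), t(τ_p)) φ_p(τ)`. -/
def pointwiseF (F : (Fin D → ℝ) → ℝ → Fin D → ℝ) (g : Grid t₀ tf M)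
    (Q : Fin M → Fin (N + 1) → Fin D → ℝ) (n : Fin M) (τ : ℝ) : Fin D → ℝ :=
  ∑ p, (phi N p).eval τ • F (Q n p) (g.time n (node N p))

/-- The improved local solution on a cell,
`q_n^IL(τ) = u_n + Δt_n ∫₀^τ F(q_n(ξ), t(ξ)) dξ` with `F` evaluated point-wise. -/
def improvedLocalSol (F : (Fin D → ℝ) → ℝ → Fin D → ℝ) (g : Grid t₀ tf M)
    (U : Fin (M + 1) → Fin D → ℝ) (Q : Fin M → Fin (N + 1) → Fin D → ℝ)
    (n : Fin M) (τ : ℝ) : Fin D → ℝ :=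
  U n.castSucc + g.step n • ∫ ξ in (0 : ℝ)..τ, pointwiseF F g Q n ξ

/-- The local solution `u_L` on the whole interval. -/
def uL (g : Grid t₀ tf M) (Q : Fin M → Fin (N + 1) → Fin D → ℝ) : ℝ → Fin D → ℝ :=
  g.assemble (localSol Q)

/-- The improved local solution `u_IL` on the whole interval. -/
def uIL (F : (Fin D → ℝ) → ℝ → Fin D → ℝ) (g : Grid t₀ tf M)
    (U : Fin (M + 1) → Fin D → ℝ) (Q : Fin M → Fin (N + 1) → Fin D → ℝ) : ℝ → Fin D → ℝ :=
  g.assemble (improvedLocalSol F g U Q)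

end ADERDG

end

/-!
ADER-DG with local predictor is the Runge–Kutta method with tableau `(A, w, τ)`. The matrix `A`
integrates polynomials of degree `N - 1` exactly at the nodes, so the stages of the exact solution
have defect `O(Δt^(N+1))`. For `N ≥ 1` the `w`-weighted sum of these defects is one order smaller:
`wᵀ A` is integration against `1 - τ`, and Gauss quadrature is exact on the resulting integrands.
Linearizing `F` along the exact solution, only this weighted sum enters the update at leading order,
which gives a local error `O(Δt^(N+3))` and, by a discrete Gronwall inequality, nodal errors
`O(Δt^(N+2))`. The stage values, hence the local solution, are only accurate to `O(Δt^(N+1))`;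
integrating the interpolant of `F` over a cell multiplies this error by another `Δt`.
-/

noncomputable section

namespace ADERDG

section LegendreRoots

/-- Integration over `[a, b]` as a linear functional on polynomials. -/
def integralₗ (a b : ℝ) : ℝ[X] →ₗ[ℝ] ℝ where
  toFun P := ∫ x in a..b, P.eval x
  map_add' P Q := by
    simp only [eval_add]
    exact intervalIntegral.integral_add (P.continuous.intervalIntegrable a b)
      (Q.continuous.intervalIntegrable a b)
  map_smul' r P := by
    simp only [eval_smul, RingHom.id_apply]
    exact intervalIntegral.integral_smul r _

theorem integralₗ_apply (a b : ℝ) (P : ℝ[X]) : integralₗ a b P = ∫ x in a..b, P.eval x := rfl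

theorem integralₗ_derivative (a b : ℝ) (P : ℝ[X]) :
    integralₗ a b (derivative P) = P.eval b - P.eval a :=
  intervalIntegral.integral_eq_sub_of_hasDerivAt (fun x _ => P.hasDerivAt x)
    ((derivative P).continuous.intervalIntegrable a b)

theorem integralₗ_derivative_mul (a b : ℝ) (P Q : ℝ[X]) :
    integralₗ a b (derivative P * Q) =
      P.eval b * Q.eval b - P.eval a * Q.eval a - integralₗ a b (P * derivative Q) := by
  rw [eq_sub_iff_add_eq, ← map_add, ← derivative_mul, integralₗ_derivative, eval_mul, eval_mul]

theorem eval_iterate_derivative_eq_zero {R : Type*} [CommRing R] {n k : ℕ} (hk : k < n)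
    {W : R[X]} {c : R} (h : (X - C c) ^ n ∣ W) : (derivative^[k] W).eval c = 0 :=
  dvd_iff_isRoot.1 <| (dvd_pow_self _ (Nat.sub_ne_zero_of_lt hk)).trans
    (pow_sub_dvd_iterate_derivative_of_pow_dvd k h)

theorem integralₗ_iterate_derivative_mul {n k : ℕ} (hk : k ≤ n) {a b : ℝ} {W : ℝ[X]}
    (ha : (X - C a) ^ n ∣ W) (hb : (X - C b) ^ n ∣ W) (Q : ℝ[X]) :
    integralₗ a b (derivative^[k] W * Q) = (-1) ^ k * integralₗ a b (W * derivative^[k] Q) := by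
  induction k generalizing Q with
  | zero => simp
  | succ k ih =>
    rw [Function.iterate_succ_apply', integralₗ_derivative_mul,
      eval_iterate_derivative_eq_zero hk ha, eval_iterate_derivative_eq_zero hk hb,
      ih (Nat.le_of_succ_le hk), Function.iterate_succ_apply]
    ring

theorem natDegree_legendre (n : ℕ) : (legendre n).natDegree = n := by
  rw [legendre, natDegree_map_eq_of_injective (RingHom.injective_int _), natDegree_shiftedLegendre]

theorem legendre_ne_zero (n : ℕ) : legendre n ≠ 0 := by
  rw [legendre, Polynomial.map_ne_zero_iff (RingHom.injective_int _), ← degree_ne_bot,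
    degree_shiftedLegendre]
  exact WithBot.natCast_ne_bot n

theorem factorial_smul_legendre (n : ℕ) :
    (n.factorial : ℝ) • legendre n = derivative^[n] (X ^ n * (1 - X) ^ n) := by
  have h := congrArg (Polynomial.map (Int.castRingHom ℝ)) (factorial_mul_shiftedLegendre_eq n)
  simpa [legendre, ← Polynomial.iterate_derivative_map, smul_eq_C_mul] using h

theorem integralₗ_legendre_mul {n : ℕ} {Q : ℝ[X]} (hQ : Q.natDegree < n) :
    integralₗ 0 1 (legendre n * Q) = 0 := by
  have hone : (X - C (1 : ℝ)) ∣ 1 - X := ⟨-1, by simp⟩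
  have hparts := integralₗ_iterate_derivative_mul (le_refl n) (a := 0) (b := 1)
    (W := X ^ n * (1 - X) ^ n) (by simp) ((pow_dvd_pow_of_dvd hone n).mul_left _) Q
  rw [← factorial_smul_legendre, iterate_derivative_eq_zero hQ, mul_zero, map_zero, mul_zero,
    smul_mul_assoc, map_smul] at hparts
  exact (smul_eq_zero.1 hparts).resolve_left (by positivity)

theorem eq_zero_of_integralₗ_eq_zero {P : ℝ[X]} {a b : ℝ} (hab : a < b)
    (hP : ∀ x ∈ Icc a b, 0 ≤ P.eval x) (hint : integralₗ a b P = 0) : P = 0 := by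
  have hroot : ∀ x ∈ Icc a b, P.eval x = 0 := by
    by_contra! ⟨x, hx, hne⟩
    exact (intervalIntegral.integral_pos hab P.continuousOn
      (fun y hy => hP y (Ioc_subset_Icc_self hy)) ⟨x, hx, (hP x hx).lt_of_ne' hne⟩).ne' hint
  exact eq_zero_of_infinite_isRoot P ((Icc_infinite hab).mono hroot)

theorem natDegree_eq_zero_of_dvd_legendre {n : ℕ} {d : ℝ[X]} (hd : d ∣ legendre n)
    (hsign : (∀ x ∈ Icc (0 : ℝ) 1, 0 ≤ d.eval x) ∨ ∀ x ∈ Icc (0 : ℝ) 1, d.eval x ≤ 0) :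
    d.natDegree = 0 := by
  obtain ⟨m, hm⟩ := hd
  obtain ⟨hd0, hm0⟩ : d ≠ 0 ∧ m ≠ 0 := mul_ne_zero_iff.1 (hm ▸ legendre_ne_zero n)
  by_contra hdeg
  have hlt : m.natDegree < n := by
    have := natDegree_legendre n
    rw [hm, natDegree_mul hd0 hm0] at this
    omega
  -- Otherwise the cofactor `m` has lower degree, yet `d * m * m` is orthogonal to constants.
  have hint : integralₗ 0 1 (d * m * m) = 0 := hm ▸ integralₗ_legendre_mul hlt
  refine mul_ne_zero (mul_ne_zero hd0 hm0) hm0 ?_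
  rcases hsign with hpos | hneg
  · refine eq_zero_of_integralₗ_eq_zero zero_lt_one (fun x hx => ?_) hint
    rw [mul_assoc, eval_mul, eval_mul]
    exact mul_nonneg (hpos x hx) (mul_self_nonneg _)
  · refine neg_eq_zero.1 (eq_zero_of_integralₗ_eq_zero zero_lt_one (fun x hx => ?_) ?_)
    · rw [mul_assoc, eval_neg, eval_mul, eval_mul, neg_nonneg]
      exact mul_nonpos_of_nonpos_of_nonneg (hneg x hx) (mul_self_nonneg _)
    · rw [map_neg, hint, neg_zero]

theorem eval_nonneg_or_nonpos_of_ne_zero {d : ℝ[X]} (h : ∀ x, d.eval x ≠ 0) :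
    (∀ x, 0 ≤ d.eval x) ∨ ∀ x, d.eval x ≤ 0 := by
  by_contra! ⟨⟨x, hx⟩, y, hy⟩
  obtain ⟨z, hz⟩ := mem_range_of_exists_le_of_exists_ge d.continuous ⟨x, hx.le⟩ ⟨y, hy.le⟩
  exact h z hz

theorem splits_legendre (n : ℕ) : (legendre n).Splits := by
  obtain ⟨q, hprod, hcard, hroots⟩ := exists_prod_multiset_X_sub_C_mul (legendre n)
  have hq0 : q ≠ 0 := right_ne_zero_of_mul (hprod ▸ legendre_ne_zero n)
  have hnoroot : ∀ x, q.eval x ≠ 0 := fun x hx => by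
    simpa [hroots] using (mem_roots hq0).2 hx
  have hconst : q.natDegree = 0 := natDegree_eq_zero_of_dvd_legendre (Dvd.intro_left _ hprod) <|
    (eval_nonneg_or_nonpos_of_ne_zero hnoroot).imp (fun h x _ => h x) fun h x _ => h x
  rw [splits_iff_card_roots, ← hcard, hconst, add_zero]

theorem mem_Ioo_of_mem_roots_legendre {n : ℕ} {x : ℝ} (hx : x ∈ (legendre n).roots) :
    x ∈ Ioo (0 : ℝ) 1 := by
  by_contra hout
  rw [mem_Ioo, not_and_or, not_lt, not_lt] at hout
  refine one_ne_zero ((natDegree_X_sub_C x).symm.trans (natDegree_eq_zero_of_dvd_legendre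
    (dvd_iff_isRoot.2 (isRoot_of_mem_roots hx)) ?_))
  simp only [eval_sub, eval_X, eval_C, sub_nonneg, sub_nonpos]
  exact hout.imp (fun h y hy => h.trans hy.1) fun h y hy => hy.2.trans h

theorem nodup_roots_legendre (n : ℕ) : (legendre n).roots.Nodup := by
  classical
  refine Multiset.nodup_iff_count_le_one.2 fun x => ?_
  rw [count_roots]
  by_contra! hmult
  have hconst := natDegree_eq_zero_of_dvd_legendre
    ((pow_dvd_pow (X - C x) hmult).trans (pow_rootMultiplicity_dvd _ _))
    (Or.inl fun y _ => by rw [eval_pow]; exact sq_nonneg _)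
  rw [natDegree_pow, natDegree_X_sub_C] at hconst
  omega

theorem length_sort_roots_legendre (n : ℕ) :
    ((legendre n).roots.toFinset.sort (· ≤ ·)).length = n := by
  rw [Finset.length_sort, Multiset.toFinset_card_of_nodup (nodup_roots_legendre n),
    ← (splits_legendre n).natDegree_eq_card_roots, natDegree_legendre]

theorem node_eq_getElem (N : ℕ) (k : Fin (N + 1)) :
    node N k = ((legendre (N + 1)).roots.toFinset.sort (· ≤ ·))[(k : ℕ)]'(by
      rw [length_sort_roots_legendre]; exact k.2) := by
  rw [node, List.getD_eq_getElem]

theorem node_injective (N : ℕ) : Function.Injective (node N) := by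
  intro i j h
  rw [node_eq_getElem, node_eq_getElem] at h
  exact Fin.ext ((List.Nodup.getElem_inj_iff (Finset.sort_nodup _ _)).1 h)

theorem node_mem_roots (N : ℕ) (k : Fin (N + 1)) : node N k ∈ (legendre (N + 1)).roots := by
  rw [node_eq_getElem, ← Multiset.mem_toFinset, ← Finset.mem_sort (· ≤ ·)]
  exact List.getElem_mem _

theorem node_mem_Icc (N : ℕ) (k : Fin (N + 1)) : node N k ∈ Icc (0 : ℝ) 1 :=
  Ioo_subset_Icc_self (mem_Ioo_of_mem_roots_legendre (node_mem_roots N k))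

theorem legendre_dvd_of_eval_node_eq_zero {N : ℕ} {P : ℝ[X]}
    (h : ∀ k, P.eval (node N k) = 0) : legendre (N + 1) ∣ P := by
  rcases eq_or_ne P 0 with rfl | hP
  · exact dvd_zero _
  refine (splits_legendre _).dvd_of_roots_le_roots (legendre_ne_zero _) <|
    (Multiset.le_iff_subset (nodup_roots_legendre _)).2 fun x hx => ?_
  rw [← Multiset.mem_toFinset, ← Finset.mem_sort (· ≤ ·)] at hx
  obtain ⟨k, hk, rfl⟩ := List.getElem_of_mem hx
  rw [length_sort_roots_legendre] at hk
  rw [mem_roots hP, ← node_eq_getElem N ⟨k, hk⟩]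
  exact h ⟨k, hk⟩

end LegendreRoots

section NodalMatrices

open Matrix

variable {N : ℕ}

/-- The vector of values of a polynomial at the Gauss nodes, which are also its coefficients in the
basis `phi N` when the degree is at most `N`. -/
def nodalValues (N : ℕ) (P : ℝ[X]) : Fin (N + 1) → ℝ :=
  fun p => P.eval (node N p)

theorem sum_nodalValues_smul_phi {P : ℝ[X]} (hP : P.natDegree ≤ N) :
    ∑ p, nodalValues N P p • phi N p = P := by
  have hdeg : P.degree < (Finset.univ : Finset (Fin (N + 1))).card := by
    rw [Finset.card_univ, Fintype.card_fin]
    exact (degree_le_of_natDegree_le hP).trans_lt (by exact_mod_cast N.lt_succ_self)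
  simpa [Lagrange.interpolate_apply, phi, nodalValues, smul_eq_C_mul] using
    (Lagrange.eq_interpolate (node_injective N).injOn hdeg).symm

theorem map_eq_sum_nodalValues_smul {V : Type*} [AddCommMonoid V] [Module ℝ V]
    (f : ℝ[X] →ₗ[ℝ] V) {P : ℝ[X]} (hP : P.natDegree ≤ N) :
    f P = ∑ p, nodalValues N P p • f (phi N p) := by
  conv_lhs => rw [← sum_nodalValues_smul_phi hP, map_sum]
  simp only [map_smul]

theorem natDegree_phi_le (N : ℕ) (p : Fin (N + 1)) : (phi N p).natDegree ≤ N :=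
  natDegree_le_of_degree_le <| by
    rw [phi, Lagrange.degree_basis (node_injective N).injOn (Finset.mem_univ p)]
    simp

theorem eval_phi_node (N : ℕ) (p q : Fin (N + 1)) :
    (phi N p).eval (node N q) = if p = q then 1 else 0 := by
  split_ifs with h
  · subst h
    exact Lagrange.eval_basis_self (node_injective N).injOn (Finset.mem_univ _)
  · exact Lagrange.eval_basis_of_ne h (Finset.mem_univ _)

theorem exists_natDegree_le_nodalValues_eq (a : Fin (N + 1) → ℝ) :
    ∃ P : ℝ[X], P.natDegree ≤ N ∧ nodalValues N P = a :=
  ⟨∑ p, a p • phi N p,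
    natDegree_sum_le_of_forall_le _ _ fun p _ =>
      (natDegree_smul_le _ _).trans (natDegree_phi_le N p),
    funext fun q => by simp [nodalValues, eval_finsetSum, eval_phi_node]⟩

theorem weight_dotProduct_nodalValues_of_natDegree_le {P : ℝ[X]} (hP : P.natDegree ≤ N) :
    weight N ⬝ᵥ nodalValues N P = integralₗ 0 1 P := by
  rw [map_eq_sum_nodalValues_smul (integralₗ 0 1) hP, dotProduct_comm]
  rfl

/-- Gauss quadrature: dividing by the Legendre polynomial doubles the degree of exactness. -/
theorem weight_dotProduct_nodalValues {P : ℝ[X]} (hP : P.natDegree ≤ 2 * N + 1) :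
    weight N ⬝ᵥ nodalValues N P = integralₗ 0 1 P := by
  obtain ⟨I, hI, hIval⟩ := exists_natDegree_le_nodalValues_eq (nodalValues N P)
  obtain ⟨q, hq⟩ : legendre (N + 1) ∣ P - I := legendre_dvd_of_eval_node_eq_zero fun k => by
    rw [eval_sub, sub_eq_zero]
    exact (congrFun hIval k).symm
  have hqdeg : q.natDegree < N + 1 := by
    rcases eq_or_ne q 0 with rfl | hq0
    · simp
    have hsub : (P - I).natDegree ≤ 2 * N + 1 :=
      natDegree_sub_le_of_le hP (hI.trans (by omega)) |>.trans (max_self _).le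
    rw [hq, natDegree_mul (legendre_ne_zero _) hq0, natDegree_legendre] at hsub
    omega
  rw [← hIval, weight_dotProduct_nodalValues_of_natDegree_le hI, eq_comm, ← sub_eq_zero, ← map_sub,
    hq, integralₗ_legendre_mul hqdeg]

theorem nodalValues_dotProduct_bilin_mulVec (B : ℝ[X] →ₗ[ℝ] ℝ[X] →ₗ[ℝ] ℝ) {P Q : ℝ[X]}
    (hP : P.natDegree ≤ N) (hQ : Q.natDegree ≤ N) :
    nodalValues N P ⬝ᵥ Matrix.of (fun p q => B (phi N p) (phi N q)) *ᵥ nodalValues N Q = B P Q := by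
  rw [map_eq_sum_nodalValues_smul B hP, LinearMap.sum_apply]
  refine Finset.sum_congr rfl fun p _ => ?_
  rw [LinearMap.smul_apply, map_eq_sum_nodalValues_smul (B (phi N p)) hQ, smul_eq_mul]
  simp only [mulVec, dotProduct, of_apply, smul_eq_mul, mul_comm]

theorem nodalValues_dotProduct_matM_mulVec {P Q : ℝ[X]} (hP : P.natDegree ≤ N)
    (hQ : Q.natDegree ≤ N) :
    nodalValues N P ⬝ᵥ matM N *ᵥ nodalValues N Q = integralₗ 0 1 (P * Q) := by
  have hM : matM N = Matrix.of fun p q =>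
      (LinearMap.mul ℝ ℝ[X]).compr₂ (integralₗ 0 1) (phi N p) (phi N q) := by
    ext p q
    simp [matM, integralₗ_apply]
  rw [hM, nodalValues_dotProduct_bilin_mulVec _ hP hQ, LinearMap.compr₂_apply,
    LinearMap.mul_apply']

theorem nodalValues_dotProduct_matK_mulVec {P Q : ℝ[X]} (hP : P.natDegree ≤ N)
    (hQ : Q.natDegree ≤ N) :
    nodalValues N P ⬝ᵥ matK N *ᵥ nodalValues N Q =
      P.eval 1 * Q.eval 1 - integralₗ 0 1 (derivative P * Q) := by
  have hK : matK N = Matrix.of fun p q => ((LinearMap.mul ℝ ℝ[X]).compr₂ (leval 1) -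
      (LinearMap.mul ℝ ℝ[X]).compr₂ (integralₗ 0 1) ∘ₗ derivative) (phi N p) (phi N q) := by
    ext p q
    simp [matK, integralₗ_apply]
  rw [hK, nodalValues_dotProduct_bilin_mulVec _ hP hQ]
  simp

theorem isUnit_matK (N : ℕ) : IsUnit (matK N) := by
  rw [isUnit_iff_isUnit_det, isUnit_iff_ne_zero]
  intro hdet
  obtain ⟨a, ha0, ha⟩ := exists_vecMul_eq_zero_iff.2 hdet
  obtain ⟨P, hP, rfl⟩ := exists_natDegree_le_nodalValues_eq a
  have horth : ∀ Q : ℝ[X], Q.natDegree ≤ N →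
      P.eval 1 * Q.eval 1 = integralₗ 0 1 (derivative P * Q) := fun Q hQ => by
    rw [← sub_eq_zero, ← nodalValues_dotProduct_matK_mulVec hP hQ, dotProduct_mulVec, ha,
      zero_dotProduct]
  have hP1 : P.eval 1 = 0 := by
    have henergy := integralₗ_derivative_mul 0 1 P P
    rw [mul_comm P, ← horth P hP] at henergy
    nlinarith [mul_self_nonneg (P.eval 1), mul_self_nonneg (P.eval 0)]
  have hder : derivative P = 0 := by
    have hsq := horth (derivative P) ((natDegree_derivative_le P).trans (by omega))
    rw [hP1, zero_mul] at hsq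
    refine mul_self_eq_zero.1 (eq_zero_of_integralₗ_eq_zero zero_lt_one (fun x _ => ?_) hsq.symm)
    rw [eval_mul]
    exact mul_self_nonneg _
  refine ha0 (funext fun k => ?_)
  rw [eq_C_of_derivative_eq_zero hder, eval_C] at hP1
  rw [nodalValues, eq_C_of_derivative_eq_zero hder, eval_C, hP1, Pi.zero_apply]

theorem matA_mulVec_nodalValues_derivative {P : ℝ[X]} (hP : P.natDegree ≤ N) :
    matA N *ᵥ nodalValues N (derivative P) = nodalValues N (P - C (P.eval 0)) := by
  have hP' : (P - C (P.eval 0)).natDegree ≤ N := natDegree_sub_C.trans_le hP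
  have hderiv : (derivative P).natDegree ≤ N := (natDegree_derivative_le P).trans (by omega)
  have hKM : matM N *ᵥ nodalValues N (derivative P) =
      matK N *ᵥ nodalValues N (P - C (P.eval 0)) := by
    refine dotProduct_eq _ _ fun a => ?_
    obtain ⟨Q, hQ, rfl⟩ := exists_natDegree_le_nodalValues_eq a
    rw [dotProduct_comm, dotProduct_comm _ (nodalValues N Q),
      nodalValues_dotProduct_matM_mulVec hQ hderiv, nodalValues_dotProduct_matK_mulVec hQ hP',
      integralₗ_derivative_mul]
    simp
  rw [matA, ← mulVec_mulVec, hKM, mulVec_mulVec,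
    nonsing_inv_mul _ ((isUnit_iff_isUnit_det _).1 (isUnit_matK N)), one_mulVec]

theorem natDegree_one_sub_X_le (hN : 1 ≤ N) : (1 - X : ℝ[X]).natDegree ≤ N :=
  natDegree_sub_le_of_le (natDegree_one.trans_le N.zero_le) (natDegree_X.trans_le hN)
    |>.trans (max_self N).le

theorem weight_vecMul_matA (hN : 1 ≤ N) :
    weight N ᵥ* matA N = nodalValues N (1 - X) ᵥ* matM N := by
  have hK : nodalValues N (1 - X) ᵥ* matK N = weight N := by
    refine dotProduct_eq _ _ fun a => ?_
    obtain ⟨Q, hQ, rfl⟩ := exists_natDegree_le_nodalValues_eq a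
    rw [← dotProduct_mulVec, nodalValues_dotProduct_matK_mulVec (natDegree_one_sub_X_le hN) hQ,
      weight_dotProduct_nodalValues_of_natDegree_le hQ]
    simp
  rw [matA, ← hK, vecMul_vecMul, ← Matrix.mul_assoc,
    mul_nonsing_inv _ ((isUnit_iff_isUnit_det _).1 (isUnit_matK N)), Matrix.one_mul]

theorem weight_dotProduct_matA_mulVec_nodalValues_derivative (hN : 1 ≤ N) {P : ℝ[X]}
    (hP : P.natDegree ≤ N + 1) :
    weight N ⬝ᵥ matA N *ᵥ nodalValues N (derivative P) =
      weight N ⬝ᵥ nodalValues N (P - C (P.eval 0)) := by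
  have hderiv : (derivative P).natDegree ≤ N := (natDegree_derivative_le P).trans (by omega)
  have hP' : (P - C (P.eval 0)).natDegree ≤ 2 * N + 1 := natDegree_sub_C.trans_le (by omega)
  have hparts := integralₗ_derivative_mul 0 1 (P - C (P.eval 0)) (1 - X)
  rw [dotProduct_mulVec, weight_vecMul_matA hN, ← dotProduct_mulVec,
    nodalValues_dotProduct_matM_mulVec (natDegree_one_sub_X_le hN) hderiv, mul_comm,
    weight_dotProduct_nodalValues hP']
  simpa using hparts

end NodalMatrices

theorem add_mul_mem_Icc {a b t h θ : ℝ} (hθ : θ ∈ Icc (0 : ℝ) 1) (hh : 0 ≤ h)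
    (ht : t ∈ Icc a b) (hth : t + h ∈ Icc a b) : t + θ * h ∈ Icc a b :=
  ⟨by linarith [ht.1, mul_nonneg hθ.1 hh], by linarith [hth.2, mul_le_of_le_one_left hh hθ.2]⟩

section TaylorExpansion

variable {E : Type*} [NormedAddCommGroup E] [NormedSpace ℝ E] {a b B : ℝ} {m : ℕ}
  {f f' : ℝ → E} {c : ℕ → ℝ → E}

/-- A forward Taylor expansion of `f` on `[a, b]` with `m` terms, whose remainder is bounded
uniformly in the base point. The coefficients `c` absorb the factorials. -/
def HasTaylorBound (f : ℝ → E) (c : ℕ → ℝ → E) (a b : ℝ) (m : ℕ) (B : ℝ) : Prop :=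
  ∀ t s, t ∈ Icc a b → 0 ≤ s → t + s ∈ Icc a b →
    ‖f (t + s) - ∑ k ∈ Finset.range m, s ^ k • c k t‖ ≤ B * s ^ m

/-- The Taylor coefficients of a function with values `f` and derivative coefficients `c`. -/
def integratedCoeff (f : ℝ → E) (c : ℕ → ℝ → E) : ℕ → ℝ → E
  | 0 => f
  | k + 1 => fun t => (k + 1 : ℝ)⁻¹ • c k t

theorem sum_integratedCoeff (f : ℝ → E) (c : ℕ → ℝ → E) (m : ℕ) (t s : ℝ) :
    ∑ k ∈ Finset.range (m + 1), s ^ k • integratedCoeff f c k t =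
      f t + ∑ k ∈ Finset.range m, (s ^ (k + 1) / (k + 1)) • c k t := by
  rw [Finset.sum_range_succ', add_comm]
  simp only [integratedCoeff, pow_zero, one_smul, smul_smul, div_eq_mul_inv]

theorem hasDerivAt_sum_pow_succ_div_smul (d : ℕ → E) (m : ℕ) (x : ℝ) :
    HasDerivAt (fun s : ℝ => ∑ k ∈ Finset.range m, (s ^ (k + 1) / (k + 1)) • d k)
      (∑ k ∈ Finset.range m, x ^ k • d k) x := by
  refine HasDerivAt.fun_sum fun k _ => ?_
  have hpow := ((hasDerivAt_pow (k + 1) x).div_const ((k : ℝ) + 1)).smul_const (d k)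
  simpa [mul_div_cancel_left₀ _ (Nat.cast_add_one_ne_zero (R := ℝ) k)] using hpow

theorem HasTaylorBound.integrate (hf : ∀ t ∈ Icc a b, HasDerivWithinAt f (f' t) (Icc a b) t)
    (hB : 0 ≤ B) (h : HasTaylorBound f' c a b m B) :
    HasTaylorBound f (integratedCoeff f c) a b (m + 1) B := by
  intro t s ht hs hts
  have hmem : ∀ x ∈ Icc 0 s, t + x ∈ Icc a b := fun x hx =>
    ⟨by linarith [ht.1, hx.1], by linarith [hts.2, hx.2]⟩
  have hshift : ∀ x ∈ Icc 0 s, HasDerivWithinAt (fun x => f (t + x)) (f' (t + x)) (Icc 0 s) x :=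
    fun x hx => by
      simpa [Function.comp_def] using
        (hf _ (hmem x hx)).scomp x ((hasDerivWithinAt_id x _).const_add t) hmem
  have hderiv : ∀ x ∈ Icc 0 s, HasDerivWithinAt
      (fun x => f (t + x) - ∑ k ∈ Finset.range m, (x ^ (k + 1) / (k + 1)) • c k t)
      (f' (t + x) - ∑ k ∈ Finset.range m, x ^ k • c k t) (Icc 0 s) x := fun x hx =>
    (hshift x hx).sub (hasDerivAt_sum_pow_succ_div_smul _ m x).hasDerivWithinAt
  have hmvt := norm_image_sub_le_of_norm_deriv_le_segment' hderiv (C := B * s ^ m)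
    (fun x hx => (h t x ht hx.1 (hmem x (Ico_subset_Icc_self hx))).trans
      (mul_le_mul_of_nonneg_left (pow_le_pow_left₀ hx.1 hx.2.le m) hB)) s (right_mem_Icc.2 hs)
  rw [sum_integratedCoeff, ← sub_sub, sub_right_comm, pow_succ, ← mul_assoc]
  simpa using hmvt

theorem exists_hasTaylorBound (hab : a < b) (hf : ContDiffOn ℝ m f (Icc a b)) :
    ∃ B ≥ 0, ∃ c, HasTaylorBound f c a b m B := by
  induction m generalizing f with
  | zero =>
    obtain ⟨B, hB⟩ := isCompact_Icc.exists_bound_of_continuousOn hf.continuousOn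
    exact ⟨B, (norm_nonneg _).trans (hB a (left_mem_Icc.2 hab.le)), fun _ _ => 0,
      fun t s _ _ hts => by simpa using hB _ hts⟩
  | succ m ih =>
    have hunique := uniqueDiffOn_Icc hab
    rw [Nat.cast_succ] at hf
    obtain ⟨hdiff, -, hderiv⟩ := (contDiffOn_succ_iff_derivWithin hunique).1 hf
    obtain ⟨B, hB, c, hc⟩ := ih hderiv
    exact ⟨B, hB, _, hc.integrate (fun t ht => (hdiff t ht).hasDerivWithinAt) hB⟩

theorem sum_smul_taylor_eq {J ι : Type*} [Fintype J] [Fintype ι] {β θ : J → ℝ} {α τ : ι → ℝ}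
    (hexact : ∀ k < m, (k + 1) * ∑ i, α i * τ i ^ k = ∑ j, β j * θ j ^ (k + 1))
    (d : ℕ → E) (s : ℝ) :
    ∑ j, β j • ∑ k ∈ Finset.range m, ((θ j * s) ^ (k + 1) / (k + 1)) • d k =
      ∑ i, α i • s • ∑ k ∈ Finset.range m, (τ i * s) ^ k • d k := by
  simp only [Finset.smul_sum, smul_smul]
  rw [Finset.sum_comm, Finset.sum_comm (s := Finset.univ (α := ι))]
  refine Finset.sum_congr rfl fun k hk => ?_
  rw [← Finset.sum_smul, ← Finset.sum_smul]
  congr 1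
  calc ∑ j, β j * ((θ j * s) ^ (k + 1) / (k + 1))
      = (∑ j, β j * θ j ^ (k + 1)) * (s ^ (k + 1) / (k + 1)) := by
        rw [Finset.sum_mul]
        exact Finset.sum_congr rfl fun j _ => by ring
    _ = (∑ i, α i * τ i ^ k) * s ^ (k + 1) := by
        rw [← hexact k (Finset.mem_range.1 hk)]
        field_simp
    _ = ∑ i, α i * (s * (τ i * s) ^ k) := by
        rw [Finset.sum_mul]
        exact Finset.sum_congr rfl fun i _ => by ring

theorem HasTaylorBound.norm_quadrature_defect_le {J ι : Type*} [Fintype J] [Fintype ι]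
    (hf : ∀ t ∈ Icc a b, HasDerivWithinAt f (f' t) (Icc a b) t) (hB : 0 ≤ B)
    (h : HasTaylorBound f' c a b m B) {β θ : J → ℝ} {α τ : ι → ℝ}
    (hθ : ∀ j, θ j ∈ Icc (0 : ℝ) 1) (hτ : ∀ i, τ i ∈ Icc (0 : ℝ) 1)
    (hexact : ∀ k < m, (k + 1) * ∑ i, α i * τ i ^ k = ∑ j, β j * θ j ^ (k + 1))
    {t s : ℝ} (hs : 0 ≤ s) (ht : t ∈ Icc a b) (hts : t + s ∈ Icc a b) :
    ‖∑ j, β j • (f (t + θ j * s) - f t) - s • ∑ i, α i • f' (t + τ i * s)‖ ≤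
      (∑ j, |β j| + ∑ i, |α i|) * (B * s ^ (m + 1)) := by
  have hmem : ∀ x ∈ Icc (0 : ℝ) 1, 0 ≤ x * s ∧ x * s ≤ s ∧ t + x * s ∈ Icc a b := fun x hx =>
    ⟨mul_nonneg hx.1 hs, mul_le_of_le_one_left hs hx.2, add_mul_mem_Icc hx hs ht hts⟩
  set Rf : ℝ → E := fun x =>
    f (t + x) - f t - ∑ k ∈ Finset.range m, (x ^ (k + 1) / (k + 1)) • c k t with hRf
  set Rf' : ℝ → E := fun x => f' (t + x) - ∑ k ∈ Finset.range m, x ^ k • c k t with hRf'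
  have hRf_le : ∀ x ∈ Icc (0 : ℝ) 1, ‖Rf (x * s)‖ ≤ B * s ^ (m + 1) := fun x hx => by
    obtain ⟨h0, h1, hin⟩ := hmem x hx
    have hint := h.integrate hf hB t (x * s) ht h0 hin
    rw [sum_integratedCoeff, ← sub_sub] at hint
    exact hint.trans (by gcongr)
  have hRf'_le : ∀ x ∈ Icc (0 : ℝ) 1, ‖s • Rf' (x * s)‖ ≤ B * s ^ (m + 1) := fun x hx => by
    obtain ⟨h0, h1, hin⟩ := hmem x hx
    rw [norm_smul, Real.norm_of_nonneg hs, pow_succ', mul_left_comm]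
    exact mul_le_mul_of_nonneg_left ((h t (x * s) ht h0 hin).trans (by gcongr)) hs
  have hsplit : ∑ j, β j • (f (t + θ j * s) - f t) - s • ∑ i, α i • f' (t + τ i * s) =
      ∑ j, β j • Rf (θ j * s) - ∑ i, α i • s • Rf' (τ i * s) := by
    simp only [hRf, hRf', smul_sub, Finset.sum_sub_distrib, Finset.smul_sum (r := s),
      smul_comm s (α _), sum_smul_taylor_eq hexact]
    abel
  rw [hsplit, add_mul, Finset.sum_mul, Finset.sum_mul]
  refine (norm_sub_le _ _).trans (add_le_add ?_ ?_) <;>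
    refine norm_sum_le_of_le _ fun i _ => ?_ <;>
    rw [norm_smul, Real.norm_eq_abs]
  · exact mul_le_mul_of_nonneg_left (hRf_le _ (hθ i)) (abs_nonneg _)
  · exact mul_le_mul_of_nonneg_left (hRf'_le _ (hτ i)) (abs_nonneg _)

theorem HasTaylorBound.norm_sub_quadrature_le {ι : Type*} [Fintype ι]
    (hf : ∀ t ∈ Icc a b, HasDerivWithinAt f (f' t) (Icc a b) t) (hB : 0 ≤ B)
    (h : HasTaylorBound f' c a b m B) {α θ : ι → ℝ} {τ : ℝ}
    (hθ : ∀ i, θ i ∈ Icc (0 : ℝ) 1) (hτ : τ ∈ Icc (0 : ℝ) 1)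
    (hexact : ∀ k < m, (k + 1) * ∑ i, α i * θ i ^ k = τ ^ (k + 1))
    {t s : ℝ} (hs : 0 ≤ s) (ht : t ∈ Icc a b) (hts : t + s ∈ Icc a b) :
    ‖f (t + τ * s) - f t - s • ∑ i, α i • f' (t + θ i * s)‖ ≤
      (1 + ∑ i, |α i|) * (B * s ^ (m + 1)) := by
  simpa using h.norm_quadrature_defect_le hf hB (β := fun _ : Unit => 1) (θ := fun _ => τ)
    (fun _ => hτ) hθ (by simpa using hexact) hs ht hts

theorem HasTaylorBound.norm_interpolation_sub_le {ι : Type*} [Fintype ι]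
    (hf : ∀ t ∈ Icc a b, HasDerivWithinAt f (f' t) (Icc a b) t) (hB : 0 ≤ B)
    (h : HasTaylorBound f' c a b m B) {β θ : ι → ℝ} {τ : ℝ}
    (hθ : ∀ i, θ i ∈ Icc (0 : ℝ) 1) (hτ : τ ∈ Icc (0 : ℝ) 1)
    (hexact : ∀ k ≤ m, ∑ i, β i * θ i ^ k = τ ^ k)
    {t s : ℝ} (hs : 0 ≤ s) (ht : t ∈ Icc a b) (hts : t + s ∈ Icc a b) :
    ‖∑ i, β i • f (t + θ i * s) - f (t + τ * s)‖ ≤ (∑ i, |β i| + 1) * (B * s ^ (m + 1)) := by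
  have hsum : ∑ i, β i = 1 := by simpa using hexact 0 m.zero_le
  have hdefect := h.norm_quadrature_defect_le hf hB (α := (fun e => nomatch e : Empty → ℝ))
    (τ := fun e => nomatch e) (β := Sum.elim β fun _ : Unit => -1) (θ := Sum.elim θ fun _ => τ)
    (Sum.forall.2 ⟨hθ, fun _ => hτ⟩) nofun (fun k hk => by simp [hexact (k + 1) hk]) hs ht hts
  have hcancel : ∑ i, β i • f (t + θ i * s) - f (t + τ * s) =
      ∑ i, β i • (f (t + θ i * s) - f t) + -(f (t + τ * s) - f t) := by
    simp only [smul_sub, Finset.sum_sub_distrib, ← Finset.sum_smul, hsum, one_smul]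
    abel
  simpa [hcancel] using hdefect

end TaylorExpansion

section Linearization

variable {E : Type*} [NormedAddCommGroup E] [NormedSpace ℝ E]

theorem exists_norm_sub_sub_clm_le [ProperSpace E] {F : E → ℝ → E} {a b : ℝ} (hab : a < b)
    (hF : ContDiffOn ℝ 2 (fun z : E × ℝ => F z.1 z.2) (univ ×ˢ Icc a b)) (R : ℝ) :
    ∃ K ≥ 0, ∀ x₀ ∈ Metric.closedBall (0 : E) R, ∀ t₀ ∈ Icc a b, ∃ J : E →L[ℝ] E, ‖J‖ ≤ K ∧
      ∀ r : ℝ, ∀ t ∈ Icc a b, |t - t₀| ≤ r →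
      ∀ x ∈ Metric.closedBall (0 : E) R ∩ Metric.closedBall x₀ r,
      ∀ y ∈ Metric.closedBall (0 : E) R ∩ Metric.closedBall x₀ r,
        ‖F y t - F x t - J (y - x)‖ ≤ K * r * ‖y - x‖ := by
  set S : Set (E × ℝ) := univ ×ˢ Icc a b
  set G' : E × ℝ → E × ℝ →L[ℝ] E := fderivWithin ℝ (fun z => F z.1 z.2) S
  set S' : Set (E × ℝ) := Metric.closedBall 0 R ×ˢ Icc a b
  have hS : UniqueDiffOn ℝ S := uniqueDiffOn_univ.prod (uniqueDiffOn_Icc hab)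
  have hcompact : IsCompact S' := (isCompact_closedBall 0 R).prod isCompact_Icc
  have hG' : ContDiffOn ℝ 1 G' S' :=
    (hF.fderivWithin hS (by norm_num)).mono (prod_mono_left (subset_univ _))
  obtain ⟨K₁, hK₁⟩ := hG'.exists_lipschitzOnWith one_ne_zero
    ((convex_closedBall 0 R).prod (convex_Icc a b)) hcompact
  obtain ⟨K₂, hK₂⟩ := hcompact.exists_bound_of_continuousOn hG'.continuousOn
  set inl := ContinuousLinearMap.inl ℝ E ℝ
  have hinl : ∀ T : E × ℝ →L[ℝ] E, ‖T ∘L inl‖ ≤ ‖T‖ := fun T =>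
    (T.opNorm_comp_le _).trans
      (mul_le_of_le_one_right (norm_nonneg _) (ContinuousLinearMap.norm_inl_le_one ℝ E ℝ))
  refine ⟨max K₁ K₂, le_max_of_le_left K₁.2, fun x₀ hx₀ t₀ ht₀ => ⟨G' (x₀, t₀) ∘L inl,
    (hinl _).trans ((hK₂ _ ⟨hx₀, ht₀⟩).trans (le_max_right _ _)), fun r t ht htr x hx y hy => ?_⟩⟩
  refine Convex.norm_image_sub_le_of_norm_hasFDerivWithin_le'
    (f := fun z => F z t) (f' := fun z => G' (z, t) ∘L inl) (fun z _ => ?_) (fun z hz => ?_)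
    ((convex_closedBall 0 R).inter (convex_closedBall x₀ r)) hx hy
  · have hderiv : HasFDerivWithinAt (fun z : E × ℝ => F z.1 z.2) (G' (z, t)) S (z, t) :=
      (hF.differentiableOn (by norm_num) (z, t) ⟨mem_univ z, ht⟩).hasFDerivWithinAt
    exact hderiv.comp (f := fun w => (w, t)) z (hasFDerivAt_prodMk_left z t).hasFDerivWithinAt
      fun w _ => ⟨mem_univ w, ht⟩
  · rw [← ContinuousLinearMap.sub_comp]
    refine (hinl _).trans ((hK₁.norm_sub_le ⟨hz.1, ht⟩ ⟨hx₀, ht₀⟩).trans ?_)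
    have hdist : ‖(z, t) - (x₀, t₀)‖ ≤ r :=
      norm_prod_le_iff.2 ⟨mem_closedBall_iff_norm.1 hz.2, htr⟩
    gcongr
    exact le_max_left _ _

end Linearization

/-- The coefficients of a Runge–Kutta method: stage matrix, weights and abscissae. -/
structure ButcherTableau (ι : Type*) where
  A : Matrix ι ι ℝ
  b : ι → ℝ
  c : ι → ℝ

namespace ButcherTableau

variable {ι E : Type*} [Fintype ι] [NormedAddCommGroup E]
  (T : ButcherTableau ι) {F : E → ℝ → E} {L : NNReal} {u : ℝ → E} {a b t h : ℝ} {m : ℕ}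
  {y : E} {Q : ι → E}

/-- The values of `f` at the abscissae of the step from `t` to `t + h`. -/
def samples (f : ℝ → E) (t h : ℝ) : ι → E :=
  fun p => f (t + T.c p * h)

/-- The values of the vector field `F` at the stages `Q`. -/
def slopes (F : E → ℝ → E) (t h : ℝ) (Q : ι → E) : ι → E :=
  fun p => F (Q p) (t + T.c p * h)

theorem lipschitzWith_slopes (hLip : ∀ p, LipschitzWith L fun x => F x (t + T.c p * h)) :
    LipschitzWith L (T.slopes F t h) :=
  LipschitzWith.of_dist_le_mul fun Q Q' => (dist_pi_le_iff (by positivity)).2 fun p =>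
    ((hLip p).dist_le_mul _ _).trans (by gcongr; exact dist_le_pi_dist Q Q' p)

variable [NormedSpace ℝ E]

/-- Multiplication of a vector of stages by the stage matrix. -/
def stageOp (E : Type*) [NormedAddCommGroup E] [NormedSpace ℝ E] : (ι → E) →L[ℝ] ι → E :=
  ContinuousLinearMap.pi fun p => ∑ q, T.A p q • ContinuousLinearMap.proj q

/-- The weighted sum of a vector of stages. -/
def weightOp (E : Type*) [NormedAddCommGroup E] [NormedSpace ℝ E] : (ι → E) →L[ℝ] E :=
  ∑ q, T.b q • ContinuousLinearMap.proj q

/-- `Q` solves the (implicit) stage equations of the step of length `h` from `y` at time `t`. -/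
def IsStageVector (F : E → ℝ → E) (t h : ℝ) (y : E) (Q : ι → E) : Prop :=
  ∀ p, Q p - h • ∑ q, T.A p q • F (Q q) (t + T.c q * h) = y

/-- The residual of the function `f` with derivative `f'` in the stage equations. -/
def stageDefect (f f' : ℝ → E) (t h : ℝ) : ι → E :=
  T.samples f t h - Function.const ι (f t) - h • T.stageOp E (T.samples f' t h)

/-- The residual of the function `f` with derivative `f'` in the update formula. -/
def updateDefect (f f' : ℝ → E) (t h : ℝ) : E :=
  f (t + h) - f t - h • T.weightOp E (T.samples f' t h)

/-- Butcher's simplifying assumptions `C(m)` and `B(m + 2)`, together with the requirement that the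
weighted stages be exact one degree beyond `C(m)`. -/
structure OrderConditions (m : ℕ) : Prop where
  abscissae : ∀ p, T.c p ∈ Icc (0 : ℝ) 1
  stage : ∀ k < m, (k + 1 : ℝ) • (T.A.mulVec (T.c ^ k)) = T.c ^ (k + 1)
  weighted : ∀ k < m + 1, (k + 1 : ℝ) * (T.A.vecMul T.b ⬝ᵥ T.c ^ k) = T.b ⬝ᵥ T.c ^ (k + 1)
  quadrature : ∀ k < m + 2, (k + 1 : ℝ) * (T.b ⬝ᵥ T.c ^ k) = 1

variable {T}

theorem stageOp_apply (w : ι → E) (p : ι) : T.stageOp E w p = ∑ q, T.A p q • w q := by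
  simp [stageOp]

theorem weightOp_apply (w : ι → E) : T.weightOp E w = ∑ q, T.b q • w q := by
  simp [weightOp]

theorem isStageVector_iff : T.IsStageVector F t h y Q ↔
    Q = Function.const ι y + h • T.stageOp E (T.slopes F t h Q) := by
  simp only [funext_iff, IsStageVector, sub_eq_iff_eq_add, Pi.add_apply, Pi.smul_apply,
    stageOp_apply, Function.const_apply, slopes]

theorem exists_isStageVector [CompleteSpace E]
    (hLip : ∀ p, LipschitzWith L fun x => F x (t + T.c p * h)) (hh : 0 ≤ h)
    (hsmall : h * ‖T.stageOp E‖ * L ≤ 1 / 2) (y : E) : ∃ Q, T.IsStageVector F t h y Q := by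
  have hcontr : ContractingWith (1 / 2) fun Q =>
      Function.const ι y + h • T.stageOp E (T.slopes F t h Q) := by
    refine ⟨NNReal.half_lt_self one_ne_zero, LipschitzWith.of_dist_le_mul fun Q Q' => ?_⟩
    rw [dist_add_left, dist_smul₀, Real.norm_of_nonneg hh]
    calc h * dist (T.stageOp E (T.slopes F t h Q)) (T.stageOp E (T.slopes F t h Q'))
        ≤ h * (‖T.stageOp E‖ * (L * dist Q Q')) := by
          gcongr
          exact ((T.stageOp E).lipschitz.dist_le_mul _ _).trans
            (by gcongr; exacts [le_rfl, (T.lipschitzWith_slopes hLip).dist_le_mul _ _])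
      _ = h * ‖T.stageOp E‖ * L * dist Q Q' := by ring
      _ ≤ (1 / 2 : NNReal) * dist Q Q' := by gcongr; exact_mod_cast hsmall
  exact ⟨_, isStageVector_iff.2 hcontr.fixedPoint_isFixedPt.eq.symm⟩

section Defects

variable {f f' : ℝ → E}

theorem weightOp_stageOp (w : ι → E) :
    T.weightOp E (T.stageOp E w) = ∑ q, T.A.vecMul T.b q • w q := by
  simp only [weightOp_apply, stageOp_apply, Finset.smul_sum, smul_smul, Matrix.vecMul, dotProduct,
    Finset.sum_smul]
  exact Finset.sum_comm

theorem stageDefect_apply (p : ι) : T.stageDefect f f' t h p =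
    f (t + T.c p * h) - f t - h • ∑ q, T.A p q • f' (t + T.c q * h) := by
  simp only [stageDefect, samples, Pi.sub_apply, Pi.smul_apply, Function.const_apply, stageOp_apply]

theorem weightOp_stageDefect : T.weightOp E (T.stageDefect f f' t h) =
    ∑ p, T.b p • (f (t + T.c p * h) - f t) - h • ∑ q, T.A.vecMul T.b q • f' (t + T.c q * h) := by
  rw [stageDefect, map_sub, map_smul, weightOp_stageOp, weightOp_apply]
  rfl

theorem OrderConditions.exists_norm_stageDefect_le (hT : T.OrderConditions m) (hab : a < b)
    (hf : ∀ t ∈ Icc a b, HasDerivWithinAt f (f' t) (Icc a b) t)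
    (hf' : ContDiffOn ℝ m f' (Icc a b)) :
    ∃ S ≥ 0, ∀ t h, 0 ≤ h → t ∈ Icc a b → t + h ∈ Icc a b →
      ‖T.stageDefect f f' t h‖ ≤ S * h ^ (m + 1) := by
  obtain ⟨B, hB, c, hc⟩ := exists_hasTaylorBound hab hf'
  have hrow : ∀ p, ∑ q, |T.A p q| ≤ ∑ p, ∑ q, |T.A p q| := fun p =>
    Finset.single_le_sum (f := fun p => ∑ q, |T.A p q|)
      (fun p _ => Finset.sum_nonneg fun q _ => abs_nonneg _) (Finset.mem_univ p)
  refine ⟨(1 + ∑ p, ∑ q, |T.A p q|) * B, by positivity, fun t h hh ht hth => ?_⟩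
  refine (pi_norm_le_iff_of_nonneg (by positivity)).2 fun p => ?_
  have hdefect := hc.norm_quadrature_defect_le hf hB (β := fun _ : Unit => 1)
    (θ := fun _ => T.c p) (α := T.A p) (fun _ => hT.abscissae p) hT.abscissae
    (fun k hk => by simpa [Matrix.mulVec, dotProduct] using congrFun (hT.stage k hk) p) hh ht hth
  rw [stageDefect_apply, mul_assoc]
  simp only [Finset.univ_unique, Finset.sum_const, Finset.card_singleton, one_smul,
    abs_one] at hdefect
  exact hdefect.trans (mul_le_mul_of_nonneg_right (add_le_add_right (hrow p) 1) (by positivity))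

theorem OrderConditions.exists_norm_weightOp_stageDefect_le (hT : T.OrderConditions m)
    (hab : a < b) (hf : ∀ t ∈ Icc a b, HasDerivWithinAt f (f' t) (Icc a b) t)
    (hf' : ContDiffOn ℝ (m + 1 : ℕ) f' (Icc a b)) :
    ∃ S ≥ 0, ∀ t h, 0 ≤ h → t ∈ Icc a b → t + h ∈ Icc a b →
      ‖T.weightOp E (T.stageDefect f f' t h)‖ ≤ S * h ^ (m + 2) := by
  obtain ⟨B, hB, c, hc⟩ := exists_hasTaylorBound hab hf'
  refine ⟨(∑ p, |T.b p| + ∑ q, |T.A.vecMul T.b q|) * B, by positivity, fun t h hh ht hth => ?_⟩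
  rw [weightOp_stageDefect, mul_assoc]
  exact hc.norm_quadrature_defect_le hf hB hT.abscissae hT.abscissae hT.weighted hh ht hth

theorem OrderConditions.exists_norm_updateDefect_le (hT : T.OrderConditions m) (hab : a < b)
    (hf : ∀ t ∈ Icc a b, HasDerivWithinAt f (f' t) (Icc a b) t)
    (hf' : ContDiffOn ℝ (m + 2 : ℕ) f' (Icc a b)) :
    ∃ S ≥ 0, ∀ t h, 0 ≤ h → t ∈ Icc a b → t + h ∈ Icc a b →
      ‖T.updateDefect f f' t h‖ ≤ S * h ^ (m + 3) := by
  obtain ⟨B, hB, c, hc⟩ := exists_hasTaylorBound hab hf'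
  refine ⟨(1 + ∑ q, |T.b q|) * B, by positivity, fun t h hh ht hth => ?_⟩
  have hdefect := hc.norm_quadrature_defect_le hf hB (β := fun _ : Unit => 1)
    (θ := fun _ => 1) (α := T.b) (fun _ => right_mem_Icc.2 zero_le_one) hT.abscissae
    (fun k hk => by simpa [dotProduct] using hT.quadrature k hk) hh ht hth
  rw [updateDefect, weightOp_apply, mul_assoc]
  simpa [samples] using hdefect

end Defects

section OneStep

theorem samples_sub_stageDefect {v : ℝ → E} : T.samples u t h - T.stageDefect u v t h =
    Function.const ι (u t) + h • T.stageOp E (T.samples v t h) := by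
  rw [stageDefect]
  abel

/-- Subtracting the stage defect from the exact solution gains one order on the stages. -/
theorem IsStageVector.norm_sub_corrected_le (hQ : T.IsStageVector F t h y Q)
    (hLip : ∀ p, LipschitzWith L fun x => F x (t + T.c p * h)) (hh : 0 ≤ h) :
    ‖Q - (T.samples u t h - T.stageDefect u (fun s => F (u s) s) t h)‖ ≤
      ‖y - u t‖ + h * ‖T.stageOp E‖ * L * ‖Q - T.samples u t h‖ := by
  have hdiff : Q - (T.samples u t h - T.stageDefect u (fun s => F (u s) s) t h) =
      Function.const ι (y - u t) +
        h • T.stageOp E (T.slopes F t h Q - T.slopes F t h (T.samples u t h)) := by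
    rw [samples_sub_stageDefect, map_sub, smul_sub]
    nth_rw 1 [isStageVector_iff.1 hQ]
    exact add_sub_add_comm _ _ _ _
  rw [hdiff]
  refine norm_add_le_of_le (pi_norm_const_le _) ?_
  rw [norm_smul, Real.norm_of_nonneg hh, mul_assoc, mul_assoc]
  exact mul_le_mul_of_nonneg_left ((T.stageOp E).le_opNorm_of_le
    ((T.lipschitzWith_slopes hLip).norm_sub_le _ _)) hh

theorem IsStageVector.norm_sub_samples_le (hQ : T.IsStageVector F t h y Q)
    (hLip : ∀ p, LipschitzWith L fun x => F x (t + T.c p * h)) (hh : 0 ≤ h)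
    (hsmall : h * ‖T.stageOp E‖ * L ≤ 1 / 2) :
    ‖Q - T.samples u t h‖ ≤
      2 * (‖y - u t‖ + ‖T.stageDefect u (fun s => F (u s) s) t h‖) := by
  have hcorrected := hQ.norm_sub_corrected_le (u := u) hLip hh
  have htriangle := norm_sub_le_norm_sub_add_norm_sub Q
    (T.samples u t h - T.stageDefect u (fun s => F (u s) s) t h) (T.samples u t h)
  rw [sub_sub_cancel_left, norm_neg] at htriangle
  linarith [mul_le_mul_of_nonneg_right hsmall (norm_nonneg (Q - T.samples u t h))]

theorem norm_weightOp_slopes_sub_le {X d : ι → E} {ρ : ℝ}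
    (hLip : ∀ p, LipschitzWith L fun x => F x (t + T.c p * h)) (hρ : 0 ≤ ρ) (J : E →L[ℝ] E)
    (hJ : ∀ p, ‖F (X p - d p) (t + T.c p * h) - F (X p) (t + T.c p * h) + J (d p)‖ ≤ ρ * ‖d p‖) :
    ‖T.weightOp E (T.slopes F t h Q - T.slopes F t h X)‖ ≤
      ‖T.weightOp E‖ * (L * ‖Q - (X - d)‖ + ρ * ‖d‖) + ‖J‖ * ‖T.weightOp E d‖ := by
  set Rem : ι → E := fun p =>
    F (X p - d p) (t + T.c p * h) - F (X p) (t + T.c p * h) + J (d p)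
  have hsplit : T.slopes F t h Q - T.slopes F t h X =
      (T.slopes F t h Q - T.slopes F t h (X - d) + Rem) - fun p => J (d p) := by
    funext p
    simp only [Rem, slopes, Pi.sub_apply, Pi.add_apply]
    abel
  have hcomm : T.weightOp E (fun p => J (d p)) = J (T.weightOp E d) := by
    simp only [weightOp_apply, map_sum, map_smul]
  have hRem : ‖Rem‖ ≤ ρ * ‖d‖ := (pi_norm_le_iff_of_nonneg (by positivity)).2 fun p =>
    (hJ p).trans (by gcongr; exact norm_le_pi_norm d p)
  rw [hsplit, map_sub, hcomm]
  exact norm_sub_le_of_le ((T.weightOp E).le_opNorm_of_le (norm_add_le_of_le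
    ((T.lipschitzWith_slopes hLip).norm_sub_le _ _) hRem)) (J.le_opNorm _)

theorem IsStageVector.norm_step_sub_le {ρ : ℝ} (hQ : T.IsStageVector F t h y Q)
    (hLip : ∀ p, LipschitzWith L fun x => F x (t + T.c p * h)) (hh : 0 ≤ h)
    (hsmall : h * ‖T.stageOp E‖ * L ≤ 1 / 2) (hρ : 0 ≤ ρ) (J : E →L[ℝ] E)
    (hJ : ∀ p, ‖F (T.samples u t h p - T.stageDefect u (fun s => F (u s) s) t h p)
          (t + T.c p * h) - F (T.samples u t h p) (t + T.c p * h) +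
          J (T.stageDefect u (fun s => F (u s) s) t h p)‖ ≤
        ρ * ‖T.stageDefect u (fun s => F (u s) s) t h p‖) :
    ‖y + h • T.weightOp E (T.slopes F t h Q) - u (t + h)‖ ≤ ‖y - u t‖ +
      h * (‖T.weightOp E‖ * (L * (2 * ‖y - u t‖ + 2 * (h * ‖T.stageOp E‖ * L) *
          ‖T.stageDefect u (fun s => F (u s) s) t h‖) +
          ρ * ‖T.stageDefect u (fun s => F (u s) s) t h‖) +
        ‖J‖ * ‖T.weightOp E (T.stageDefect u (fun s => F (u s) s) t h)‖) +
      ‖T.updateDefect u (fun s => F (u s) s) t h‖ := by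
  set X := T.samples u t h
  set d := T.stageDefect u (fun s => F (u s) s) t h
  have hcorrected : ‖Q - (X - d)‖ ≤ 2 * ‖y - u t‖ + 2 * (h * ‖T.stageOp E‖ * L) * ‖d‖ := by
    have hstages := mul_le_mul_of_nonneg_left (hQ.norm_sub_samples_le (u := u) hLip hh hsmall)
      (by positivity : 0 ≤ h * ‖T.stageOp E‖ * L)
    linarith [hQ.norm_sub_corrected_le (u := u) hLip hh,
      mul_le_mul_of_nonneg_right hsmall (norm_nonneg (y - u t))]
  have hsplit : y + h • T.weightOp E (T.slopes F t h Q) - u (t + h) = (y - u t) +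
      h • T.weightOp E (T.slopes F t h Q - T.slopes F t h X) -
        T.updateDefect u (fun s => F (u s) s) t h := by
    have hX : T.slopes F t h X = T.samples (fun s => F (u s) s) t h := rfl
    rw [updateDefect, map_sub, smul_sub, hX]
    abel
  rw [hsplit]
  refine norm_sub_le_of_le (norm_add_le_of_le le_rfl ?_) le_rfl
  rw [norm_smul, Real.norm_of_nonneg hh]
  refine mul_le_mul_of_nonneg_left ((norm_weightOp_slopes_sub_le hLip hρ J hJ).trans ?_) hh
  gcongr

end OneStep

section LocalError

theorem norm_corrected_samples_sub_le {v : ℝ → E} {V : ℝ} (hc : ∀ p, T.c p ∈ Icc (0 : ℝ) 1)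
    (hv : ∀ s ∈ Icc a b, ‖v s‖ ≤ V) (hV : 0 ≤ V) (hh : 0 ≤ h) (ht : t ∈ Icc a b)
    (hth : t + h ∈ Icc a b) (p : ι) :
    ‖T.samples u t h p - T.stageDefect u v t h p - u t‖ ≤ ‖T.stageOp E‖ * V * h := by
  have hsamples : ‖T.samples v t h‖ ≤ V := (pi_norm_le_iff_of_nonneg hV).2 fun q =>
    hv _ (add_mul_mem_Icc (hc q) hh ht hth)
  rw [← Pi.sub_apply, samples_sub_stageDefect, Pi.add_apply, Function.const_apply,
    add_sub_cancel_left, Pi.smul_apply, norm_smul, Real.norm_of_nonneg hh, mul_comm]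
  exact mul_le_mul_of_nonneg_right
    ((norm_le_pi_norm _ p).trans ((T.stageOp E).le_opNorm_of_le hsamples)) hh

theorem exists_linearization_at_corrected_samples [ProperSpace E]
    (hc : ∀ p, T.c p ∈ Icc (0 : ℝ) 1) (hab : a < b)
    (hF : ContDiffOn ℝ 2 (fun z : E × ℝ => F z.1 z.2) (univ ×ˢ Icc a b))
    (hu : ∀ t ∈ Icc a b, HasDerivWithinAt u (F (u t) t) (Icc a b) t) :
    ∃ K ≥ 0, ∀ t h, 0 ≤ h → t ∈ Icc a b → t + h ∈ Icc a b → ∃ J : E →L[ℝ] E, ‖J‖ ≤ K ∧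
      ∀ p, ‖F (T.samples u t h p - T.stageDefect u (fun s => F (u s) s) t h p) (t + T.c p * h) -
          F (T.samples u t h p) (t + T.c p * h) +
          J (T.stageDefect u (fun s => F (u s) s) t h p)‖ ≤
        K * h * ‖T.stageDefect u (fun s => F (u s) s) t h p‖ := by
  have hucont : ContinuousOn u (Icc a b) := fun t ht => (hu t ht).continuousWithinAt
  obtain ⟨U, hU⟩ := isCompact_Icc.exists_bound_of_continuousOn hucont
  obtain ⟨V, hV⟩ := isCompact_Icc.exists_bound_of_continuousOn
    (hF.continuousOn.comp (hucont.prodMk continuousOn_id) fun t ht => ⟨mem_univ _, ht⟩)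
  have hV0 : 0 ≤ V := (norm_nonneg _).trans (hV a (left_mem_Icc.2 hab.le))
  set W := ‖T.stageOp E‖ * V
  have hW0 : 0 ≤ W := by positivity
  obtain ⟨K, hK, hlin⟩ := exists_norm_sub_sub_clm_le hab hF (U + W * (b - a))
  refine ⟨K * (W + V + 1), by positivity, fun t h hh ht hth => ?_⟩
  have hbound : ∀ s ∈ Icc a b, u s ∈ Metric.closedBall 0 (U + W * (b - a)) := fun s hs =>
    mem_closedBall_zero_iff.2 ((hU s hs).trans
      (le_add_of_nonneg_right (mul_nonneg hW0 (sub_nonneg.2 hab.le))))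
  obtain ⟨J, hJ, hJlin⟩ := hlin (u t) (hbound t ht) t ht
  refine ⟨J, hJ.trans (le_mul_of_one_le_right hK (by linarith)), fun p => ?_⟩
  have htp := add_mul_mem_Icc (hc p) hh ht hth
  have hcp : T.c p * h ≤ h := mul_le_of_le_one_left hh (hc p).2
  have habs : |t + T.c p * h - t| = T.c p * h := by
    rw [add_sub_cancel_left, abs_of_nonneg (mul_nonneg (hc p).1 hh)]
  have hX : ‖T.samples u t h p - u t‖ ≤ V * (T.c p * h) := by
    rw [← habs]
    exact (convex_Icc a b).norm_image_sub_le_of_norm_hasDerivWithin_le hu hV ht htp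
  have hZ := norm_corrected_samples_sub_le (u := u) hc hV hV0 hh ht hth p
  have hcorrected := hJlin ((W + V + 1) * h) _ htp (by rw [habs]; nlinarith) (T.samples u t h p)
    ⟨hbound _ htp, mem_closedBall_iff_norm.2 (by nlinarith)⟩
    (T.samples u t h p - T.stageDefect u (fun s => F (u s) s) t h p)
    ⟨?_, mem_closedBall_iff_norm.2 (hZ.trans (by gcongr; linarith))⟩
  · rw [sub_sub_cancel_left, map_neg, sub_neg_eq_add, norm_neg, ← mul_assoc] at hcorrected
    exact hcorrected
  · rw [mem_closedBall_zero_iff]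
    refine (norm_le_norm_add_norm_sub' _ (u t)).trans (add_le_add (hU t ht) (hZ.trans ?_))
    gcongr
    linarith [ht.1, hth.2]

theorem contDiffOn_solution [CompleteSpace E] {n : ℕ∞}
    (hF : ContDiffOn ℝ n (fun z : E × ℝ => F z.1 z.2) (univ ×ˢ Icc a b))
    (hu : ∀ t ∈ Icc a b, HasDerivWithinAt u (F (u t) t) (Icc a b) t) :
    ContDiffOn ℝ n u (Icc a b) :=
  ODE.contDiffOn_enat_Icc_of_hasDerivWithinAt (f := fun t x => F x t)
    (hF.comp (contDiff_snd.prodMk contDiff_fst).contDiffOn fun _ hz => ⟨mem_univ _, hz.1⟩) hu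
    (mapsTo_univ u _)

theorem contDiffOn_solution_deriv [CompleteSpace E] {n : ℕ∞}
    (hF : ContDiffOn ℝ n (fun z : E × ℝ => F z.1 z.2) (univ ×ˢ Icc a b))
    (hu : ∀ t ∈ Icc a b, HasDerivWithinAt u (F (u t) t) (Icc a b) t) :
    ContDiffOn ℝ n (fun t => F (u t) t) (Icc a b) :=
  hF.comp ((contDiffOn_solution hF hu).prodMk contDiffOn_id) fun _ ht => ⟨mem_univ _, ht⟩

theorem OrderConditions.exists_norm_local_stage_error_le [CompleteSpace E]
    (hT : T.OrderConditions m) (hab : a < b)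
    (hF : ContDiffOn ℝ m (fun z : E × ℝ => F z.1 z.2) (univ ×ˢ Icc a b))
    (hLip : ∀ t ∈ Icc a b, LipschitzWith L fun x => F x t)
    (hu : ∀ t ∈ Icc a b, HasDerivWithinAt u (F (u t) t) (Icc a b) t) :
    ∃ C ≥ 0, ∀ t h y Q, 0 ≤ h → t ∈ Icc a b → t + h ∈ Icc a b →
      h * ‖T.stageOp E‖ * L ≤ 1 / 2 → T.IsStageVector F t h y Q →
      ‖Q - T.samples u t h‖ ≤ 2 * ‖y - u t‖ + C * h ^ (m + 1) := by
  obtain ⟨S, hS, hstage⟩ := hT.exists_norm_stageDefect_le hab hu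
    (contDiffOn_solution_deriv (by exact_mod_cast hF) hu)
  refine ⟨2 * S, by positivity, fun t h y Q hh ht hth hsmall hQ => ?_⟩
  have herror := hQ.norm_sub_samples_le (u := u)
    (fun p => hLip _ (add_mul_mem_Icc (hT.abscissae p) hh ht hth)) hh hsmall
  linarith [hstage t h hh ht hth]

theorem OrderConditions.exists_norm_local_error_le [ProperSpace E] (hT : T.OrderConditions m)
    (hab : a < b) (hF : ContDiffOn ℝ (m + 2 : ℕ) (fun z : E × ℝ => F z.1 z.2) (univ ×ˢ Icc a b))
    (hLip : ∀ t ∈ Icc a b, LipschitzWith L fun x => F x t)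
    (hu : ∀ t ∈ Icc a b, HasDerivWithinAt u (F (u t) t) (Icc a b) t) :
    ∃ C ≥ 0, ∀ t h y Q, 0 ≤ h → t ∈ Icc a b → t + h ∈ Icc a b →
      h * ‖T.stageOp E‖ * L ≤ 1 / 2 → T.IsStageVector F t h y Q →
      ‖y + h • T.weightOp E (T.slopes F t h Q) - u (t + h)‖ ≤
        (1 + C * h) * ‖y - u t‖ + C * h ^ (m + 3) := by
  have hv : ContDiffOn ℝ (m + 2 : ℕ) (fun t => F (u t) t) (Icc a b) :=
    contDiffOn_solution_deriv (by exact_mod_cast hF) hu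
  obtain ⟨S₁, hS₁, hstage⟩ := hT.exists_norm_stageDefect_le hab hu
    (hv.of_le (by exact_mod_cast Nat.le_add_right m 2))
  obtain ⟨S₂, hS₂, hweighted⟩ := hT.exists_norm_weightOp_stageDefect_le hab hu
    (hv.of_le (by exact_mod_cast Nat.le_succ (m + 1)))
  obtain ⟨S₃, hS₃, hupdate⟩ := hT.exists_norm_updateDefect_le hab hu hv
  obtain ⟨K, hK, hlin⟩ := exists_linearization_at_corrected_samples hT.abscissae hab
    (hF.of_le (by exact_mod_cast Nat.le_add_left 2 m)) hu
  set α := ‖T.stageOp E‖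
  set β := ‖T.weightOp E‖
  refine ⟨2 * β * L + (β * (2 * α * L ^ 2 + K) * S₁ + K * S₂ + S₃), by positivity,
    fun t h y Q hh ht hth hsmall hQ => ?_⟩
  obtain ⟨J, hJ, hJlin⟩ := hlin t h hh ht hth
  have hd := hstage t h hh ht hth
  have herror := hQ.norm_step_sub_le
    (fun p => hLip _ (add_mul_mem_Icc (hT.abscissae p) hh ht hth)) hh hsmall (mul_nonneg hK hh) J
    hJlin
  calc ‖y + h • T.weightOp E (T.slopes F t h Q) - u (t + h)‖
      ≤ ‖y - u t‖ + h * (β * (L * (2 * ‖y - u t‖ + 2 * (h * α * L) * (S₁ * h ^ (m + 1))) +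
          K * h * (S₁ * h ^ (m + 1))) + K * (S₂ * h ^ (m + 2))) + S₃ * h ^ (m + 3) := by
        refine herror.trans ?_
        gcongr
        exacts [hweighted t h hh ht hth, hupdate t h hh ht hth]
    _ = (1 + 2 * β * L * h) * ‖y - u t‖ +
          (β * (2 * α * L ^ 2 + K) * S₁ + K * S₂ + S₃) * h ^ (m + 3) := by ring
    _ ≤ _ := by
        refine add_le_add ?_ (mul_le_mul_of_nonneg_right ?_ (by positivity))
        · gcongr
          exact le_add_of_nonneg_right (by positivity)
        · exact le_add_of_nonneg_left (by positivity)

end LocalError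

end ButcherTableau

namespace Grid

variable {t₀ tf t τ : ℝ} {M D K : ℕ} (g : Grid t₀ tf M) {n : Fin M}

theorem step_pos (n : Fin M) : 0 < g.step n :=
  sub_pos.2 (g.strictMono Fin.castSucc_lt_succ)

theorem step_le_mesh (n : Fin M) : g.step n ≤ g.mesh :=
  le_ciSup (f := g.step) (finite_range _).bddAbove n

theorem mesh_nonneg : 0 ≤ g.mesh :=
  Real.iSup_nonneg fun n => (g.step_pos n).le

theorem pt_succ (n : Fin M) : g.pt n.succ = g.pt n.castSucc + g.step n := by
  rw [step, add_sub_cancel]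

theorem pt_mem_Icc (n : Fin (M + 1)) : g.pt n ∈ Icc t₀ tf :=
  ⟨g.first.ge.trans (g.strictMono.monotone (Fin.zero_le n)),
    (g.strictMono.monotone (Fin.le_last n)).trans g.last.le⟩

theorem pt_add_step_mem_Icc (n : Fin M) : g.pt n.castSucc + g.step n ∈ Icc t₀ tf :=
  g.pt_succ n ▸ g.pt_mem_Icc n.succ

theorem time_mem_Icc (n : Fin M) (hτ : τ ∈ Icc (0 : ℝ) 1) : g.time n τ ∈ Icc t₀ tf :=
  add_mul_mem_Icc hτ (g.step_pos n).le (g.pt_mem_Icc _) (g.pt_add_step_mem_Icc n)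

theorem mesh_le (h : t₀ ≤ tf) : g.mesh ≤ tf - t₀ :=
  Real.iSup_le (fun _ => sub_le_sub (g.pt_mem_Icc _).2 (g.pt_mem_Icc _).1) (sub_nonneg.2 h)

theorem time_div_step (n : Fin M) (t : ℝ) :
    g.time n ((t - g.pt n.castSucc) / g.step n) = t := by
  rw [time, div_mul_cancel₀ _ (g.step_pos n).ne', add_sub_cancel]

theorem div_step_mem_Icc (ht : t ∈ Icc (g.pt n.castSucc) (g.pt n.succ)) :
    (t - g.pt n.castSucc) / g.step n ∈ Icc (0 : ℝ) 1 :=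
  ⟨div_nonneg (sub_nonneg.2 ht.1) (g.step_pos n).le,
    (div_le_one (g.step_pos n)).2 (sub_le_sub_right ht.2 _)⟩

theorem cell_subset_Icc (n : Fin M) : g.cell n ⊆ Icc (g.pt n.castSucc) (g.pt n.succ) := by
  rw [cell]
  split_ifs
  exacts [Subset.rfl, Ico_subset_Icc_self]

theorem Ico_subset_cell (n : Fin M) : Ico (g.pt n.castSucc) (g.pt n.succ) ⊆ g.cell n := by
  rw [cell]
  split_ifs
  exacts [Ico_subset_Icc_self, Subset.rfl]

theorem cell_last (g : Grid t₀ tf (K + 1)) :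
    g.cell (Fin.last K) = Icc (g.pt (Fin.last K).castSucc) tf := by
  rw [cell, if_pos (congrArg (· + 1) (Fin.val_last K)), Fin.succ_last, g.last]

theorem disjoint_cell_of_lt {n m : Fin M} (h : n < m) : Disjoint (g.cell n) (g.cell m) := by
  refine disjoint_left.2 fun t hn hm => ?_
  rw [cell, if_neg (by lia)] at hn
  exact hn.2.not_ge ((g.strictMono.monotone (Fin.succ_le_castSucc_iff.2 h)).trans
    (g.cell_subset_Icc m hm).1)

theorem pairwise_disjoint_cell : Pairwise (Function.onFun Disjoint g.cell) := fun _ _ h =>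
  h.lt_or_gt.elim g.disjoint_cell_of_lt fun h => (g.disjoint_cell_of_lt h).symm

theorem exists_mem_Ico (h₀ : t₀ ≤ t) (k : Fin (M + 1)) (hk : t < g.pt k) :
    ∃ n : Fin M, t ∈ Ico (g.pt n.castSucc) (g.pt n.succ) := by
  induction k using Fin.induction with
  | zero => exact absurd hk (g.first.trans_le h₀).not_gt
  | succ n ih => exact (lt_or_ge t (g.pt n.castSucc)).elim ih fun hn => ⟨n, hn, hk⟩

theorem exists_mem_cell (h : t₀ < tf) (ht : t ∈ Icc t₀ tf) : ∃ n, t ∈ g.cell n := by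
  rcases ht.2.lt_or_eq with hlt | rfl
  · obtain ⟨n, hn⟩ := g.exists_mem_Ico ht.1 (Fin.last M) (hlt.trans_eq g.last.symm)
    exact ⟨n, g.Ico_subset_cell n hn⟩
  · obtain _ | K := M
    · exact absurd (g.first.symm.trans g.last) h.ne
    · exact ⟨Fin.last K, g.cell_last ▸ right_mem_Icc.2 (g.pt_mem_Icc _).2⟩

section Assemble

variable {v : Fin M → ℝ → Fin D → ℝ} {U : Fin (M + 1) → Fin D → ℝ}

theorem assemble_of_mem_cell (v : Fin M → ℝ → Fin D → ℝ) (ht : t ∈ g.cell n) :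
    g.assemble v t = v n ((t - g.pt n.castSucc) / g.step n) := by
  rw [assemble, Finset.sum_eq_single n, indicator_of_mem ht]
  · exact fun m _ hm => indicator_of_notMem
      (disjoint_right.1 (g.pairwise_disjoint_cell hm) ht) _
  · simp

theorem exists_assemble_eq (h : t₀ < tf) (ht : t ∈ Icc t₀ tf) : ∃ n, ∃ τ ∈ Icc (0 : ℝ) 1,
    g.time n τ = t ∧ ∀ v : Fin M → ℝ → Fin D → ℝ, g.assemble v t = v n τ := by
  obtain ⟨n, hn⟩ := g.exists_mem_cell h ht
  exact ⟨n, _, g.div_step_mem_Icc (g.cell_subset_Icc n hn), g.time_div_step n t,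
    fun v => g.assemble_of_mem_cell v hn⟩

theorem assemble_pt_castSucc (h0 : ∀ n, v n 0 = U n.castSucc) (n : Fin M) :
    g.assemble v (g.pt n.castSucc) = U n.castSucc := by
  rw [g.assemble_of_mem_cell v (g.Ico_subset_cell n
    (left_mem_Ico.2 (g.strictMono Fin.castSucc_lt_succ))), sub_self, zero_div, h0]

theorem assemble_pt (h : t₀ < tf) (h0 : ∀ n, v n 0 = U n.castSucc) (h1 : ∀ n, v n 1 = U n.succ)
    (k : Fin (M + 1)) : g.assemble v (g.pt k) = U k := by
  obtain ⟨n, rfl⟩ | rfl := k.eq_castSucc_or_eq_last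
  · exact g.assemble_pt_castSucc h0 n
  · obtain _ | K := M
    · exact absurd (g.first.symm.trans g.last) h.ne
    · have hlast : g.pt (Fin.last (K + 1)) ∈ g.cell (Fin.last K) := by
        rw [g.cell_last, g.last]
        exact right_mem_Icc.2 (g.pt_mem_Icc _).2
      rw [g.assemble_of_mem_cell v hlast, ← Fin.succ_last, ← h1]
      exact congrArg _ (div_self (g.step_pos _).ne')

theorem assemble_of_mem_Icc (h : t₀ < tf) (h0 : ∀ n, v n 0 = U n.castSucc)
    (h1 : ∀ n, v n 1 = U n.succ) (ht : t ∈ Icc (g.pt n.castSucc) (g.pt n.succ)) :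
    g.assemble v t = v n ((t - g.pt n.castSucc) / g.step n) := by
  rcases ht.2.lt_or_eq with hlt | rfl
  · exact g.assemble_of_mem_cell v (g.Ico_subset_cell n ⟨ht.1, hlt⟩)
  · rw [g.assemble_pt h h0 h1, ← h1]
    exact congrArg _ (div_self (g.step_pos n).ne').symm

theorem continuousOn_assemble (h : t₀ < tf) (hv : ∀ n, Continuous (v n))
    (h0 : ∀ n, v n 0 = U n.castSucc) (h1 : ∀ n, v n 1 = U n.succ) :
    ContinuousOn (g.assemble v) (Icc t₀ tf) := by
  have hcover : Icc t₀ tf ⊆ ⋃ n : Fin M, Icc (g.pt n.castSucc) (g.pt n.succ) := fun t ht =>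
    let ⟨n, hn⟩ := g.exists_mem_cell h ht
    mem_iUnion.2 ⟨n, g.cell_subset_Icc n hn⟩
  refine ContinuousOn.mono ?_ hcover
  refine (locallyFinite_of_finite _).continuousOn_iUnion (fun n => isClosed_Icc) fun n => ?_
  have hpiece : Continuous fun t => v n ((t - g.pt n.castSucc) / g.step n) :=
    (hv n).comp (by fun_prop)
  exact hpiece.continuousOn.congr fun t ht => g.assemble_of_mem_Icc h h0 h1 ht

end Assemble

theorem gronwall {e : Fin (M + 1) → ℝ} {K β : ℝ} (hK : 0 ≤ K) (hβ : 0 ≤ β) (he : 0 ≤ e 0)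
    (hstep : ∀ n : Fin M, e n.succ ≤ (1 + K * g.step n) * e n.castSucc + β * g.step n)
    (k : Fin (M + 1)) : e k ≤ Real.exp (K * (g.pt k - t₀)) * (e 0 + β * (g.pt k - t₀)) := by
  induction k using Fin.induction with
  | zero => simp [g.first]
  | succ n ih =>
    have hh := (g.step_pos n).le
    have hs := sub_nonneg.2 (g.pt_mem_Icc n.castSucc).1
    have hsucc : g.pt n.succ - t₀ = g.step n + (g.pt n.castSucc - t₀) := by
      rw [g.pt_succ]
      ring
    rw [hsucc]
    set h := g.step n
    set s := g.pt n.castSucc - t₀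
    have hexp : 1 + K * h ≤ Real.exp (K * h) := by linarith [Real.add_one_le_exp (K * h)]
    have hexp' : 1 ≤ Real.exp (K * (h + s)) := Real.one_le_exp (by positivity)
    calc e n.succ
        ≤ (1 + K * h) * (Real.exp (K * s) * (e 0 + β * s)) + 1 * (β * h) := by
          rw [one_mul]
          exact (hstep n).trans (by gcongr)
      _ ≤ Real.exp (K * h) * (Real.exp (K * s) * (e 0 + β * s)) +
            Real.exp (K * (h + s)) * (β * h) := by gcongr
      _ = Real.exp (K * (h + s)) * (e 0 + β * (h + s)) := by
          rw [mul_add K, Real.exp_add]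
          ring

end Grid

namespace ButcherTableau

variable {ι E : Type*} [Fintype ι] [NormedAddCommGroup E] [NormedSpace ℝ E]
  {T : ButcherTableau ι} {F : E → ℝ → E} {L : NNReal} {u : ℝ → E} {t₀ tf : ℝ} {m M : ℕ}
  {u₀ : E} {g : Grid t₀ tf M} {U : Fin (M + 1) → E} {Q : Fin M → ι → E}

/-- `U` and `Q` are the nodal values and the stages of the Runge–Kutta method with tableau `T`
applied to `u' = F(u, t)`, `u(t₀) = u₀` on the grid `g`. -/
structure IsGridSolution (T : ButcherTableau ι) (F : E → ℝ → E) (u₀ : E) (g : Grid t₀ tf M)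
    (U : Fin (M + 1) → E) (Q : Fin M → ι → E) : Prop where
  init : U 0 = u₀
  stages : ∀ n, T.IsStageVector F (g.pt n.castSucc) (g.step n) (U n.castSucc) (Q n)
  update : ∀ n, U n.succ = U n.castSucc +
    g.step n • T.weightOp E (T.slopes F (g.pt n.castSucc) (g.step n) (Q n))

theorem exists_isGridSolution [CompleteSpace E] (hc : ∀ p, T.c p ∈ Icc (0 : ℝ) 1)
    (hLip : ∀ t ∈ Icc t₀ tf, LipschitzWith L fun x => F x t)
    (hsmall : g.mesh * ‖T.stageOp E‖ * L ≤ 1 / 2) : ∃ U Q, T.IsGridSolution F u₀ g U Q := by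
  have hstages : ∀ n y, ∃ q, T.IsStageVector F (g.pt (Fin.castSucc n)) (g.step n) y q :=
    fun n => exists_isStageVector (fun p => hLip _ (g.time_mem_Icc n (hc p))) (g.step_pos n).le
      (le_trans (by gcongr; exact g.step_le_mesh n) hsmall)
  choose q hq using hstages
  set U : Fin (M + 1) → E := Fin.induction u₀ fun n y =>
    y + g.step n • T.weightOp E (T.slopes F (g.pt n.castSucc) (g.step n) (q n y))
  exact ⟨U, fun n => q n (U n.castSucc), rfl, fun n => hq n _, fun n => Fin.induction_succ _ _ n⟩

theorem OrderConditions.exists_norm_nodal_error_le [ProperSpace E] (hT : T.OrderConditions m)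
    (ht : t₀ < tf)
    (hF : ContDiffOn ℝ (m + 2 : ℕ) (fun z : E × ℝ => F z.1 z.2) (univ ×ˢ Icc t₀ tf))
    (hLip : ∀ t ∈ Icc t₀ tf, LipschitzWith L fun x => F x t)
    (hu : ∀ t ∈ Icc t₀ tf, HasDerivWithinAt u (F (u t) t) (Icc t₀ tf) t) :
    ∃ C ≥ 0, ∀ (M : ℕ) (g : Grid t₀ tf M), g.mesh * ‖T.stageOp E‖ * L ≤ 1 / 2 →
      ∀ U Q, T.IsGridSolution F (u t₀) g U Q →
      ∀ k, ‖U k - u (g.pt k)‖ ≤ C * g.mesh ^ (m + 2) := by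
  obtain ⟨C, hC, hlocal⟩ := hT.exists_norm_local_error_le ht hF hLip hu
  have : 0 ≤ tf - t₀ := sub_nonneg.2 ht.le
  refine ⟨Real.exp (C * (tf - t₀)) * (C * (tf - t₀)), by positivity,
    fun M g hsmall U Q hsol k => ?_⟩
  have hmesh := g.mesh_nonneg
  have hstep : ∀ n : Fin M, ‖U n.succ - u (g.pt n.succ)‖ ≤
      (1 + C * g.step n) * ‖U n.castSucc - u (g.pt n.castSucc)‖ +
        C * g.mesh ^ (m + 2) * g.step n := fun n => by
    have hh := (g.step_pos n).le
    have hhm := g.step_le_mesh n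
    have herror := hlocal _ _ _ _ hh (g.pt_mem_Icc _) (g.pt_add_step_mem_Icc n)
      (le_trans (by gcongr) hsmall) (hsol.stages n)
    rw [← hsol.update, ← g.pt_succ] at herror
    refine herror.trans ?_
    rw [pow_succ _ (m + 2), ← mul_assoc]
    gcongr
  have hgronwall := g.gronwall (e := fun k => ‖U k - u (g.pt k)‖) hC (by positivity)
    (norm_nonneg _) hstep k
  rw [hsol.init, g.first, sub_self, norm_zero, zero_add] at hgronwall
  have hk := g.pt_mem_Icc k
  calc ‖U k - u (g.pt k)‖
      ≤ Real.exp (C * (tf - t₀)) * (C * g.mesh ^ (m + 2) * (tf - t₀)) := by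
        refine hgronwall.trans ?_
        have hs := sub_nonneg.2 hk.1
        gcongr
        exacts [hk.2, hk.2]
    _ = _ := by ring

theorem OrderConditions.exists_norm_stage_error_le [ProperSpace E] (hT : T.OrderConditions m)
    (ht : t₀ < tf)
    (hF : ContDiffOn ℝ (m + 2 : ℕ) (fun z : E × ℝ => F z.1 z.2) (univ ×ˢ Icc t₀ tf))
    (hLip : ∀ t ∈ Icc t₀ tf, LipschitzWith L fun x => F x t)
    (hu : ∀ t ∈ Icc t₀ tf, HasDerivWithinAt u (F (u t) t) (Icc t₀ tf) t) :
    ∃ C ≥ 0, ∀ (M : ℕ) (g : Grid t₀ tf M), g.mesh * ‖T.stageOp E‖ * L ≤ 1 / 2 →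
      ∀ U Q, T.IsGridSolution F (u t₀) g U Q →
      ∀ n, ‖Q n - T.samples u (g.pt n.castSucc) (g.step n)‖ ≤ C * g.mesh ^ (m + 1) := by
  obtain ⟨C₁, hC₁, hnodal⟩ := hT.exists_norm_nodal_error_le ht hF hLip hu
  obtain ⟨C₂, hC₂, hlocal⟩ := hT.exists_norm_local_stage_error_le ht
    (hF.of_le (by exact_mod_cast Nat.le_add_right m 2)) hLip hu
  have : 0 ≤ tf - t₀ := sub_nonneg.2 ht.le
  refine ⟨2 * C₁ * (tf - t₀) + C₂, by positivity, fun M g hsmall U Q hsol n => ?_⟩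
  have hmesh := g.mesh_nonneg
  have hh := (g.step_pos n).le
  have hhm := g.step_le_mesh n
  calc ‖Q n - T.samples u (g.pt n.castSucc) (g.step n)‖
      ≤ 2 * ‖U n.castSucc - u (g.pt n.castSucc)‖ + C₂ * g.step n ^ (m + 1) :=
        hlocal _ _ _ _ hh (g.pt_mem_Icc _) (g.pt_add_step_mem_Icc n)
          (le_trans (by gcongr) hsmall) (hsol.stages n)
    _ ≤ 2 * (C₁ * (g.mesh ^ (m + 1) * (tf - t₀))) + C₂ * g.mesh ^ (m + 1) := by
        gcongr
        exact (hnodal M g hsmall U Q hsol _).trans (by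
          rw [pow_succ _ (m + 1)]
          gcongr
          exact g.mesh_le ht.le)
    _ = _ := by ring

end ButcherTableau

section GaussTableau

open Matrix

variable {N : ℕ}

theorem nodalValues_derivative_X_pow_succ (k : ℕ) :
    nodalValues N (derivative (X ^ (k + 1))) = (k + 1 : ℝ) • node N ^ k := by
  ext p
  simp [nodalValues]

theorem nodalValues_X_pow_succ_sub_eval_zero (k : ℕ) :
    nodalValues N (X ^ (k + 1) - C ((X ^ (k + 1) : ℝ[X]).eval 0)) = node N ^ (k + 1) := by
  ext p
  simp [nodalValues]

/-- The Runge–Kutta method to which ADER-DG with local predictor is equivalent: the stages are the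
predictor coefficients. -/
def gaussTableau (N : ℕ) : ButcherTableau (Fin (N + 1)) :=
  ⟨matA N, weight N, node N⟩

theorem orderConditions_gaussTableau (hN : 1 ≤ N) : (gaussTableau N).OrderConditions N where
  abscissae := node_mem_Icc N
  stage k hk := by
    change (k + 1 : ℝ) • matA N *ᵥ node N ^ k = node N ^ (k + 1)
    rw [← mulVec_smul, ← nodalValues_derivative_X_pow_succ,
      matA_mulVec_nodalValues_derivative (natDegree_X_pow_le _ |>.trans hk),
      nodalValues_X_pow_succ_sub_eval_zero]
  weighted k hk := by
    change (k + 1 : ℝ) * (weight N ᵥ* matA N ⬝ᵥ node N ^ k) = weight N ⬝ᵥ node N ^ (k + 1)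
    rw [← dotProduct_mulVec, ← smul_eq_mul, ← dotProduct_smul, ← mulVec_smul,
      ← nodalValues_derivative_X_pow_succ,
      weight_dotProduct_matA_mulVec_nodalValues_derivative hN (natDegree_X_pow_le _ |>.trans hk),
      nodalValues_X_pow_succ_sub_eval_zero]
  quadrature k hk := by
    change (k + 1 : ℝ) * (weight N ⬝ᵥ node N ^ k) = 1
    have hdeg : (derivative (X ^ (k + 1) : ℝ[X])).natDegree ≤ 2 * N + 1 :=
      (natDegree_derivative_le _).trans (by rw [natDegree_X_pow]; omega)
    rw [← smul_eq_mul, ← dotProduct_smul, ← nodalValues_derivative_X_pow_succ,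
      weight_dotProduct_nodalValues hdeg, integralₗ_derivative]
    simp

theorem sum_eval_phi_mul_node_pow {k : ℕ} (hk : k ≤ N) (τ : ℝ) :
    ∑ p, (phi N p).eval τ * node N p ^ k = τ ^ k := by
  simpa [nodalValues, mul_comm] using
    (map_eq_sum_nodalValues_smul (leval τ) ((natDegree_X_pow_le k).trans hk)).symm

theorem sum_integral_phi_mul_node_pow {k : ℕ} (hk : k ≤ N) (τ : ℝ) :
    (k + 1) * ∑ p, (∫ ξ in (0 : ℝ)..τ, (phi N p).eval ξ) * node N p ^ k = τ ^ (k + 1) := by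
  have hsum := map_eq_sum_nodalValues_smul (integralₗ 0 τ) ((natDegree_X_pow_le k).trans hk)
  simp only [integralₗ_apply, eval_pow, eval_X, integral_pow, nodalValues, smul_eq_mul] at hsum
  simp only [mul_comm _ (node N _ ^ k), ← hsum]
  field_simp
  simp

end GaussTableau

section LocalSolutions

variable {D N M : ℕ} {t₀ tf : ℝ} {F : (Fin D → ℝ) → ℝ → Fin D → ℝ} {u₀ : Fin D → ℝ}
  {g : Grid t₀ tf M} {U : Fin (M + 1) → Fin D → ℝ} {Q : Fin M → Fin (N + 1) → Fin D → ℝ}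

theorem isSolution_iff_isGridSolution :
    IsSolution F u₀ g U Q ↔ (gaussTableau N).IsGridSolution F u₀ g U Q := by
  refine ⟨fun h => ⟨h.init, h.predictor, fun n => ?_⟩, fun h => ⟨h.init, h.stages, fun n => ?_⟩⟩
  · rw [ButcherTableau.weightOp_apply]
    exact h.update n
  · have hupdate := h.update n
    rwa [ButcherTableau.weightOp_apply] at hupdate

theorem localSol_node (Q : Fin M → Fin (N + 1) → Fin D → ℝ) (n : Fin M) (p : Fin (N + 1)) :
    localSol Q n (node N p) = Q n p := by
  simp [localSol, eval_phi_node]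

theorem improvedLocalSol_eq (F : (Fin D → ℝ) → ℝ → Fin D → ℝ) (g : Grid t₀ tf M)
    (U : Fin (M + 1) → Fin D → ℝ) (Q : Fin M → Fin (N + 1) → Fin D → ℝ) (n : Fin M) (τ : ℝ) :
    improvedLocalSol F g U Q n τ = U n.castSucc + g.step n •
      ∑ p, (∫ ξ in (0 : ℝ)..τ, (phi N p).eval ξ) • F (Q n p) (g.time n (node N p)) := by
  simp only [improvedLocalSol, pointwiseF]
  rw [intervalIntegral.integral_finsetSum fun p _ =>
    ((phi N p).continuous.fun_smul continuous_const).intervalIntegrable _ _]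
  simp only [intervalIntegral.integral_smul_const]

theorem improvedLocalSol_zero (F : (Fin D → ℝ) → ℝ → Fin D → ℝ) (g : Grid t₀ tf M)
    (U : Fin (M + 1) → Fin D → ℝ) (Q : Fin M → Fin (N + 1) → Fin D → ℝ) (n : Fin M) :
    improvedLocalSol F g U Q n 0 = U n.castSucc := by
  simp [improvedLocalSol]

theorem IsSolution.improvedLocalSol_one (h : IsSolution F u₀ g U Q) (n : Fin M) :
    improvedLocalSol F g U Q n 1 = U n.succ := by
  rw [improvedLocalSol_eq, h.update]
  rfl

theorem continuous_integral_phi (p : Fin (N + 1)) :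
    Continuous fun τ => ∫ ξ in (0 : ℝ)..τ, (phi N p).eval ξ :=
  intervalIntegral.continuous_primitive
    (fun a b => (phi N p).continuous.intervalIntegrable a b) 0

theorem continuous_improvedLocalSol (F : (Fin D → ℝ) → ℝ → Fin D → ℝ) (g : Grid t₀ tf M)
    (U : Fin (M + 1) → Fin D → ℝ) (Q : Fin M → Fin (N + 1) → Fin D → ℝ) (n : Fin M) :
    Continuous (improvedLocalSol F g U Q n) := by
  rw [funext (improvedLocalSol_eq F g U Q n)]
  exact continuous_const.add <| .fun_const_smul
    (continuous_finsetSum _ fun p _ => (continuous_integral_phi p).smul continuous_const) _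

theorem IsSolution.uIL_pt (h : IsSolution F u₀ g U Q) (ht : t₀ < tf) (n : Fin (M + 1)) :
    uIL F g U Q (g.pt n) = U n :=
  g.assemble_pt ht (improvedLocalSol_zero F g U Q) h.improvedLocalSol_one n

theorem IsSolution.continuousOn_uIL (h : IsSolution F u₀ g U Q) (ht : t₀ < tf) :
    ContinuousOn (uIL F g U Q) (Icc t₀ tf) :=
  g.continuousOn_assemble ht (continuous_improvedLocalSol F g U Q)
    (improvedLocalSol_zero F g U Q) h.improvedLocalSol_one

end LocalSolutions

section ErrorEstimates

theorem exists_sum_abs_le_of_continuous {ι : Type*} [Fintype ι] {w : ι → ℝ → ℝ}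
    (hw : ∀ p, Continuous (w p)) (a b : ℝ) : ∃ Λ ≥ 0, ∀ τ ∈ Icc a b, ∑ p, |w p τ| ≤ Λ := by
  obtain ⟨Λ, hΛ⟩ := isCompact_Icc.exists_bound_of_continuousOn
    (continuous_finsetSum Finset.univ fun p _ => (hw p).abs).continuousOn
  exact ⟨max Λ 0, le_max_right _ _, fun τ hτ =>
    (le_abs_self _).trans ((hΛ τ hτ).trans (le_max_left _ _))⟩

theorem norm_sum_smul_le {ι E : Type*} [Fintype ι] [NormedAddCommGroup E] [NormedSpace ℝ E]
    {w : ι → ℝ} {Λ : ℝ} (hw : ∑ p, |w p| ≤ Λ) (z : ι → E) : ‖∑ p, w p • z p‖ ≤ Λ * ‖z‖ :=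
  calc ‖∑ p, w p • z p‖ ≤ ∑ p, |w p| * ‖z‖ := norm_sum_le_of_le _ fun p _ => by
        rw [norm_smul, Real.norm_eq_abs]
        gcongr
        exact norm_le_pi_norm z p
    _ ≤ Λ * ‖z‖ := by
        rw [← Finset.sum_mul]
        gcongr

variable {D N : ℕ} {t₀ tf : ℝ} {F : (Fin D → ℝ) → ℝ → Fin D → ℝ} {L : NNReal}
  {u : ℝ → Fin D → ℝ}

theorem norm_improvedLocalSol_sub_le {M : ℕ} {g : Grid t₀ tf M} {U : Fin (M + 1) → Fin D → ℝ}
    {Q : Fin M → Fin (N + 1) → Fin D → ℝ} {Λ τ : ℝ}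
    (hLip : ∀ t ∈ Icc t₀ tf, LipschitzWith L fun x => F x t)
    (hΛ : ∑ p, |∫ ξ in (0 : ℝ)..τ, (phi N p).eval ξ| ≤ Λ) (n : Fin M) :
    ‖improvedLocalSol F g U Q n τ - u (g.time n τ)‖ ≤
      ‖U n.castSucc - u (g.pt n.castSucc)‖ +
      g.step n * (Λ * (L *
        ‖Q n - (gaussTableau N).samples u (g.pt n.castSucc) (g.step n)‖)) +
      ‖u (g.time n τ) - u (g.pt n.castSucc) - g.step n • ∑ p,
        (∫ ξ in (0 : ℝ)..τ, (phi N p).eval ξ) •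
          F (u (g.time n (node N p))) (g.time n (node N p))‖ := by
  set ψ : Fin (N + 1) → ℝ := fun p => ∫ ξ in (0 : ℝ)..τ, (phi N p).eval ξ
  set S := (gaussTableau N).slopes F (g.pt n.castSucc) (g.step n)
  set q := (gaussTableau N).samples u (g.pt n.castSucc) (g.step n)
  have hslopes : ‖S (Q n) - S q‖ ≤ L * ‖Q n - q‖ :=
    ((gaussTableau N).lipschitzWith_slopes fun p =>
      hLip _ (g.time_mem_Icc n (node_mem_Icc N p))).norm_sub_le _ _
  have hsplit : improvedLocalSol F g U Q n τ - u (g.time n τ) =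
      U n.castSucc - u (g.pt n.castSucc) + g.step n • ∑ p, ψ p • (S (Q n) - S q) p -
        (u (g.time n τ) - u (g.pt n.castSucc) - g.step n • ∑ p, ψ p • S q p) := by
    rw [improvedLocalSol_eq]
    simp only [Pi.sub_apply, smul_sub, Finset.sum_sub_distrib]
    change U n.castSucc + g.step n • ∑ p, ψ p • S (Q n) p - u (g.time n τ) = _
    abel
  have hΛ0 : 0 ≤ Λ := (Finset.sum_nonneg fun p _ => abs_nonneg (ψ p)).trans hΛ
  rw [hsplit]
  refine (norm_sub_le _ _).trans (add_le_add_left ((norm_add_le _ _).trans ?_) _)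
  rw [norm_smul, Real.norm_of_nonneg (g.step_pos n).le]
  gcongr
  · exact (g.step_pos n).le
  · exact (norm_sum_smul_le hΛ _).trans (by gcongr)

theorem exists_norm_improvedLocalSol_sub_le (hN : 1 ≤ N) (ht : t₀ < tf)
    (hF : ContDiffOn ℝ (N + 2 : ℕ) (fun z : (Fin D → ℝ) × ℝ => F z.1 z.2) (univ ×ˢ Icc t₀ tf))
    (hLip : ∀ t ∈ Icc t₀ tf, LipschitzWith L fun x => F x t)
    (hu : ∀ t ∈ Icc t₀ tf, HasDerivWithinAt u (F (u t) t) (Icc t₀ tf) t) :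
    ∃ C, ∀ (M : ℕ) (g : Grid t₀ tf M),
      g.mesh * ‖(gaussTableau N).stageOp (Fin D → ℝ)‖ * L ≤ 1 / 2 →
      ∀ U (Q : Fin M → Fin (N + 1) → Fin D → ℝ), IsSolution F (u t₀) g U Q →
      ∀ n, ∀ τ ∈ Icc (0 : ℝ) 1,
        ‖improvedLocalSol F g U Q n τ - u (g.time n τ)‖ ≤ C * g.mesh ^ (N + 2) := by
  have hT := orderConditions_gaussTableau hN
  obtain ⟨C₁, _, hnodal⟩ := hT.exists_norm_nodal_error_le ht hF hLip hu
  obtain ⟨C₂, _, hstage⟩ := hT.exists_norm_stage_error_le ht hF hLip hu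
  have hv : ContDiffOn ℝ (N + 2 : ℕ) (fun t => F (u t) t) (Icc t₀ tf) :=
    ButcherTableau.contDiffOn_solution_deriv (by exact_mod_cast hF) hu
  obtain ⟨B, hB, _, htaylor⟩ := exists_hasTaylorBound (m := N + 1) ht
    (hv.of_le (by exact_mod_cast Nat.le_succ (N + 1)))
  obtain ⟨Λ, hΛ, hw⟩ := exists_sum_abs_le_of_continuous (continuous_integral_phi (N := N)) 0 1
  refine ⟨C₁ + Λ * (L * C₂) + (1 + Λ) * B, fun M g hsmall U Q hsol n τ hτ => ?_⟩
  have hgrid := isSolution_iff_isGridSolution.1 hsol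
  have hh := (g.step_pos n).le
  have hm := g.mesh_nonneg
  have hdense := (htaylor.norm_sub_quadrature_le hu hB (node_mem_Icc N) hτ
    (fun k hk => sum_integral_phi_mul_node_pow (Nat.le_of_lt_succ hk) τ) hh
    (g.pt_mem_Icc _) (g.pt_add_step_mem_Icc n)).trans
      (mul_le_mul_of_nonneg_right (add_le_add_right (hw τ hτ) 1) (by positivity))
  calc ‖improvedLocalSol F g U Q n τ - u (g.time n τ)‖
      ≤ C₁ * g.mesh ^ (N + 2) + g.mesh * (Λ * (L * (C₂ * g.mesh ^ (N + 1)))) +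
          (1 + Λ) * (B * g.mesh ^ (N + 2)) := by
        refine (norm_improvedLocalSol_sub_le hLip (hw τ hτ) n).trans ?_
        gcongr
        · exact hnodal M g hsmall U Q hgrid _
        · exact g.step_le_mesh n
        · exact hstage M g hsmall U Q hgrid n
        · exact hdense.trans (by gcongr; exact g.step_le_mesh n)
    _ = (C₁ + Λ * (L * C₂) + (1 + Λ) * B) * g.mesh ^ (N + 2) := by ring

theorem exists_norm_localSol_sub_le (hN : 1 ≤ N) (ht : t₀ < tf)
    (hF : ContDiffOn ℝ (N + 2 : ℕ) (fun z : (Fin D → ℝ) × ℝ => F z.1 z.2) (univ ×ˢ Icc t₀ tf))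
    (hLip : ∀ t ∈ Icc t₀ tf, LipschitzWith L fun x => F x t)
    (hu : ∀ t ∈ Icc t₀ tf, HasDerivWithinAt u (F (u t) t) (Icc t₀ tf) t) :
    ∃ C, ∀ (M : ℕ) (g : Grid t₀ tf M),
      g.mesh * ‖(gaussTableau N).stageOp (Fin D → ℝ)‖ * L ≤ 1 / 2 →
      ∀ U (Q : Fin M → Fin (N + 1) → Fin D → ℝ), IsSolution F (u t₀) g U Q →
      ∀ n, ∀ τ ∈ Icc (0 : ℝ) 1, ‖localSol Q n τ - u (g.time n τ)‖ ≤ C * g.mesh ^ (N + 1) := by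
  obtain ⟨C, _, hstage⟩ :=
    (orderConditions_gaussTableau hN).exists_norm_stage_error_le ht hF hLip hu
  have hv : ContDiffOn ℝ (N + 2 : ℕ) (fun t => F (u t) t) (Icc t₀ tf) :=
    ButcherTableau.contDiffOn_solution_deriv (by exact_mod_cast hF) hu
  obtain ⟨B, hB, _, htaylor⟩ := exists_hasTaylorBound (m := N) ht
    (hv.of_le (by exact_mod_cast Nat.le_add_right N 2))
  obtain ⟨Λ, hΛ, hw⟩ := exists_sum_abs_le_of_continuous (fun p => (phi N p).continuous) 0 1
  refine ⟨Λ * C + (Λ + 1) * B, fun M g hsmall U Q hsol n τ hτ => ?_⟩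
  set t := g.pt n.castSucc
  set h := g.step n
  set q := (gaussTableau N).samples u t h
  have hh : 0 ≤ h := (g.step_pos n).le
  have hinterp : ‖∑ p, (phi N p).eval τ • q p - u (t + τ * h)‖ ≤
      (Λ + 1) * (B * h ^ (N + 1)) :=
    (htaylor.norm_interpolation_sub_le hu hB (node_mem_Icc N) hτ
      (fun k hk => sum_eval_phi_mul_node_pow hk τ) hh (g.pt_mem_Icc _)
      (g.pt_add_step_mem_Icc n)).trans (by gcongr; exact hw τ hτ)
  have hsplit : localSol Q n τ - u (g.time n τ) = ∑ p, (phi N p).eval τ • (Q n - q) p +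
      (∑ p, (phi N p).eval τ • q p - u (t + τ * h)) := by
    simp only [Pi.sub_apply, smul_sub, Finset.sum_sub_distrib, sub_add_sub_cancel]
    rfl
  calc ‖localSol Q n τ - u (g.time n τ)‖
      ≤ Λ * (C * g.mesh ^ (N + 1)) + (Λ + 1) * (B * g.mesh ^ (N + 1)) := by
        rw [hsplit]
        refine (norm_add_le _ _).trans (add_le_add ((norm_sum_smul_le (hw τ hτ) _).trans ?_)
          (hinterp.trans ?_))
        · gcongr
          exact hstage M g hsmall U Q (isSolution_iff_isGridSolution.1 hsol) n
        · gcongr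
          exact g.step_le_mesh n
    _ = (Λ * C + (Λ + 1) * B) * g.mesh ^ (N + 1) := by ring

theorem exists_isSolution_and_error_bound (hN : 1 ≤ N) (ht : t₀ < tf)
    (hF : ContDiffOn ℝ (N + 2 : ℕ) (fun z : (Fin D → ℝ) × ℝ => F z.1 z.2) (univ ×ˢ Icc t₀ tf))
    (hLip : ∀ t ∈ Icc t₀ tf, LipschitzWith L fun x => F x t)
    (hu : ∀ t ∈ Icc t₀ tf, HasDerivWithinAt u (F (u t) t) (Icc t₀ tf) t) :
    ∃ C > 0, ∃ δ > 0, ∀ (M : ℕ) (g : Grid t₀ tf M), g.mesh ≤ δ →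
      (∃ (U : Fin (M + 1) → Fin D → ℝ) (Q : Fin M → Fin (N + 1) → Fin D → ℝ),
        IsSolution F (u t₀) g U Q) ∧
      ∀ (U : Fin (M + 1) → Fin D → ℝ) (Q : Fin M → Fin (N + 1) → Fin D → ℝ),
        IsSolution F (u t₀) g U Q → ∀ t ∈ Icc t₀ tf,
          ‖uIL F g U Q t - u t‖ ≤ C * g.mesh ^ (N + 2) ∧
          ‖uL g Q t - u t‖ ≤ C * g.mesh ^ (N + 1) := by
  obtain ⟨C₁, himproved⟩ := exists_norm_improvedLocalSol_sub_le hN ht hF hLip hu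
  obtain ⟨C₂, hlocal⟩ := exists_norm_localSol_sub_le hN ht hF hLip hu
  set κ := ‖(gaussTableau N).stageOp (Fin D → ℝ)‖ * L
  have : 0 ≤ κ := by positivity
  refine ⟨max 1 (max C₁ C₂), by positivity, (1 / 2) / (κ + 1), by positivity,
    fun M g hmesh => ?_⟩
  have hm := g.mesh_nonneg
  have hsmall : g.mesh * ‖(gaussTableau N).stageOp (Fin D → ℝ)‖ * L ≤ 1 / 2 := by
    rw [mul_assoc]
    exact (mul_le_mul_of_nonneg_left (lt_add_one κ).le hm).trans
      ((le_div_iff₀ (by positivity)).1 hmesh)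
  refine ⟨?_, fun U Q hsol t htmem => ?_⟩
  · obtain ⟨U, Q, hsol⟩ := ButcherTableau.exists_isGridSolution (node_mem_Icc N) hLip hsmall
    exact ⟨U, Q, isSolution_iff_isGridSolution.2 hsol⟩
  · obtain ⟨n, τ, hτ, rfl, hassemble⟩ := g.exists_assemble_eq ht htmem
    rw [uIL, uL, hassemble, hassemble]
    refine ⟨(himproved M g hsmall U Q hsol n τ hτ).trans ?_,
      (hlocal M g hsmall U Q hsol n τ hτ).trans ?_⟩ <;> gcongr <;> simp

theorem eLpNorm_top_restrict_Icc_le {E : Type*} [NormedAddCommGroup E] {a b X : ℝ}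
    {f : ℝ → E} (hf : ∀ t ∈ Icc a b, ‖f t‖ ≤ X) :
    eLpNorm f ⊤ (volume.restrict (Icc a b)) ≤ ENNReal.ofReal X := by
  rw [eLpNorm_exponent_top]
  exact eLpNormEssSup_le_of_ae_bound (ae_restrict_of_forall_mem measurableSet_Icc hf)

theorem eLpNorm_restrict_Icc_le {E : Type*} [NormedAddCommGroup E] {a b X : ℝ} (hab : a ≤ b)
    {f : ℝ → E} (hf : ∀ t ∈ Icc a b, ‖f t‖ ≤ X) {p : ℝ} (hp : 0 ≤ p) :
    eLpNorm f (ENNReal.ofReal p) (volume.restrict (Icc a b)) ≤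
      ENNReal.ofReal ((b - a) ^ (1 / p) * X) := by
  have hbound := eLpNorm_le_of_ae_bound (p := ENNReal.ofReal p)
    (ae_restrict_of_forall_mem (μ := volume) measurableSet_Icc hf)
  rwa [Measure.restrict_apply_univ, Real.volume_Icc, ENNReal.toReal_ofReal hp,
    ENNReal.ofReal_rpow_of_nonneg (sub_nonneg.2 hab) (by positivity),
    ← ENNReal.ofReal_mul (Real.rpow_nonneg (sub_nonneg.2 hab) _), ← one_div] at hbound

end ErrorEstimates

end ADERDG

end

theorem mainTheorem2 (D N : ℕ) (t₀ tf : ℝ) (ht : t₀ < tf)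
    (F : (Fin D → ℝ) → ℝ → Fin D → ℝ) (u₀ : Fin D → ℝ) :
    -- matching of the nodal values and continuity, on every grid
    (∀ (M : ℕ) (g : ADERDG.Grid t₀ tf M) (U : Fin (M + 1) → Fin D → ℝ)
        (Q : Fin M → Fin (N + 1) → Fin D → ℝ), ADERDG.IsSolution F u₀ g U Q →
      (∀ n τ, ADERDG.improvedLocalSol F g U Q n τ = U n.castSucc + g.step n •
          ∑ p, (∫ ξ in (0 : ℝ)..τ, (ADERDG.phi N p).eval ξ) •
            F (ADERDG.localSol Q n (ADERDG.node N p)) (g.time n (ADERDG.node N p))) ∧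
      (∀ n, ADERDG.improvedLocalSol F g U Q n 0 = U n.castSucc) ∧
      (∀ n, ADERDG.improvedLocalSol F g U Q n 1 = U n.succ) ∧
      (∀ n, ADERDG.uIL F g U Q (g.pt n) = U n) ∧
      ContinuousOn (ADERDG.uIL F g U Q) (Icc t₀ tf)) ∧
    -- the error estimates
    (1 ≤ N →
      ContDiffOn ℝ ((N + 2 : ℕ) : WithTop ℕ∞) (fun z : (Fin D → ℝ) × ℝ => F z.1 z.2)
        (univ ×ˢ Icc t₀ tf) →
      ∀ L : ℝ, (∀ t ∈ Icc t₀ tf, ∀ x y : Fin D → ℝ, ‖F x t - F y t‖ ≤ L * ‖x - y‖) →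
      ∀ u : ℝ → Fin D → ℝ, u t₀ = u₀ →
        (∀ t ∈ Icc t₀ tf, HasDerivWithinAt u (F (u t) t) (Icc t₀ tf) t) →
      ∃ C > 0, ∃ δ > 0, ∀ (M : ℕ) (g : ADERDG.Grid t₀ tf M), g.mesh ≤ δ →
        (∃ (U : Fin (M + 1) → Fin D → ℝ) (Q : Fin M → Fin (N + 1) → Fin D → ℝ),
          ADERDG.IsSolution F u₀ g U Q) ∧
        ∀ (U : Fin (M + 1) → Fin D → ℝ) (Q : Fin M → Fin (N + 1) → Fin D → ℝ),
          ADERDG.IsSolution F u₀ g U Q →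
          (∀ t ∈ Icc t₀ tf, ‖ADERDG.uIL F g U Q t - u t‖ ≤ C * g.mesh ^ (N + 2)) ∧
          eLpNorm (fun t => ADERDG.uIL F g U Q t - u t) ⊤ (volume.restrict (Icc t₀ tf))
            ≤ ENNReal.ofReal (C * g.mesh ^ (N + 2)) ∧
          (∀ p : ℝ, 1 ≤ p →
            eLpNorm (fun t => ADERDG.uIL F g U Q t - u t) (ENNReal.ofReal p)
                (volume.restrict (Icc t₀ tf))
              ≤ ENNReal.ofReal ((tf - t₀) ^ (1 / p) * C * g.mesh ^ (N + 2))) ∧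
          eLpNorm (fun t => ADERDG.uL g Q t - u t) ⊤ (volume.restrict (Icc t₀ tf))
            ≤ ENNReal.ofReal (C * g.mesh ^ (N + 1)) ∧
          (∀ p : ℝ, 1 ≤ p →
            eLpNorm (fun t => ADERDG.uL g Q t - u t) (ENNReal.ofReal p)
                (volume.restrict (Icc t₀ tf))
              ≤ ENNReal.ofReal ((tf - t₀) ^ (1 / p) * C * g.mesh ^ (N + 1)))) := by
  refine ⟨fun M g U Q hsol => ⟨fun n τ => ?_, ADERDG.improvedLocalSol_zero F g U Q,
    hsol.improvedLocalSol_one, hsol.uIL_pt ht, hsol.continuousOn_uIL ht⟩, ?_⟩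
  · simp only [ADERDG.improvedLocalSol_eq, ADERDG.localSol_node]
  rintro hN hF L hL u rfl hu
  have hLip : ∀ t ∈ Icc t₀ tf, LipschitzWith L.toNNReal fun x => F x t := fun t htmem =>
    LipschitzWith.of_dist_le' fun x y => by simpa only [dist_eq_norm] using hL t htmem x y
  obtain ⟨C, hC, δ, hδ, hbound⟩ := ADERDG.exists_isSolution_and_error_bound hN ht hF hLip hu
  refine ⟨C, hC, δ, hδ, fun M g hmesh => ⟨(hbound M g hmesh).1, fun U Q hsol => ?_⟩⟩
  have hIL := fun t htmem => ((hbound M g hmesh).2 U Q hsol t htmem).1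
  have hloc := fun t htmem => ((hbound M g hmesh).2 U Q hsol t htmem).2
  simp only [mul_assoc _ C]
  exact ⟨hIL, ADERDG.eLpNorm_top_restrict_Icc_le hIL,
    fun p hp => ADERDG.eLpNorm_restrict_Icc_le ht.le hIL (zero_le_one.trans hp),
    ADERDG.eLpNorm_top_restrict_Icc_le hloc,
    fun p hp => ADERDG.eLpNorm_restrict_Icc_le ht.le hloc (zero_le_one.trans hp)⟩
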